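/- **Setting.** Let $d\ge 2$, $T\in\mathbb N$, let $\mathcal X\subseteq\mathbb R^d$ be closed, star-convex with respect to the origin (i.e. $\alpha x\in\mathcal X$ for $x\in\mathcal X$, $\alpha\in[0,1]$) and contained in the Euclidean unit ball, and let $\theta,a\in\mathbb R^d$, $b>0$. Put $\mathcal Y=\{x\in\mathcal X: a^\top x\le b\}$, let $x_*\in\arg\max_{x\in\mathcal Y}\theta^\top x$, and assume $\theta^\top x_*>0$. Let $S_a,S_\theta>0$ with $\|a\|\le S_a$, $\|\theta\|\le S_\theta$, let $S=\max(S_a,S_\theta)$, and assume $\nu:=b/S_a\le 1$. Let $\rho\ge 0$, $\delta\in(0,1)$, $\lambda\ge 1$. In round $t=1,\dots,T$ an action $x_t$ is played and $y_t=\theta^\top x_t+\epsilon_t$ and $z_t=a^\top x_t+\eta_t$ are observed. The noise is conditionally subgaussian: for all $t\in\{1,\dots,T\}$ and $s\in\mathbb R$, $\mathbb E[\epsilon_t\mid x_1,\epsilon_1,\dots,x_{t-1},\epsilon_{t-1},x_t]=0$ and $\mathbb E[e^{s\epsilon_t}\mid x_1,\epsilon_1,\dots,x_{t-1},\epsilon_{t-1},x_t]\le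 e^{s^2\rho^2/2}$ almost surely, and the same holds with $\epsilon$ replaced by $\eta$ throughout. **Algorithm (ROFUL).** With $\|x\|_M=\sqrt{x^\top Mx}$, let $$V_t=\lambda I+\sum_{k=1}^{t-1}x_kx_k^\top,\quad \hat\theta_t=V_t^{-1}\sum_{k=1}^{t-1}x_ky_k,\quad \hat a_t=V_t^{-1}\sum_{k=1}^{t-1}x_kz_k,\quad \beta_t=\rho\sqrt{d\log\Big(\frac{1+(t-1)/\lambda}{\delta/2}\Big)}+\sqrt\lambda\,S,$$ $$\mathcal Y_t^p=\{x\in\mathcal X:\hat a_t^\top x+\beta_t\|x\|_{V_t^{-1}}\le b\},\qquad \mathcal Y_t^o=\{x\in\mathcal X:\hat a_t^\top x-\beta_t\|x\|_{V_t^{-1}}\le b\}.$$ In each round $t$ ROFUL picks any $\tilde x_t\in\arg\max_{x\in\mathcal Y_t^o}\big(\hat\theta_t^\top x+\beta_t\|x\|_{V_t^{-1}}\big)$ and plays $x_t=\gamma_t\tilde x_t$, where $\gamma_t=\max\big(\min(\nu/\|\tilde x_t\|,1),\mu_t\big)$, $\mu_t=\max\{\mu\in[0,1]:\mu\tilde x_t\in\mathcal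 Y_t^p\}$, and $\nu/0:=\infty$. **Theorem.** With probability at least $1-\delta$, ROFUL satisfies $x_t\in\mathcal X$ and $a^\top x_t\le b$ for all $t\in\{1,\dots,T\}$, and its regret $R_T=\sum_{t=1}^T\theta^\top(x_*-x_t)$ satisfies $$R_T\le 2\,\frac{S_\theta+S_a}{b}\,\beta_T\sqrt{2dT\log\Big(1+\frac{T}{\lambda d}\Big)}.$$ The right-hand side is $\tilde{\mathcal O}(d\sqrt T/b)$: there is a constant $C$ depending only on $\rho,\delta,\lambda,S_a,S_\theta$ such that it is at most $C\,\frac{d\sqrt T}{b}\log T$ for all $T\ge 2$, all dimensions $d$ and all $b>0$. -/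

import Mathlib

open MeasureTheory
open scoped Matrix

noncomputable section

namespace SafeBandit

/-- The space of actions and parameters, `ℝ^d` with the Euclidean norm. -/
abbrev Vec (d : ℕ) : Type := EuclideanSpace ℝ (Fin d)

/-- `x` is a maximiser of `f` over the set `s`. -/
def IsArgmax {α : Type*} (f : α → ℝ) (s : Set α) (x : α) : Prop :=
  x ∈ s ∧ ∀ y ∈ s, f y ≤ f x

/-- The feasible set `{x ∈ X : aᵀ x ≤ b}`. -/
def feasible {d : ℕ} (X : Set (Vec d)) (a : Vec d) (b : ℝ) : Set (Vec d) :=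
  {x ∈ X | inner ℝ a x ≤ b}

/-- The weighted norm `‖x‖_M = √(xᵀ M x)`. -/
def weightedNorm {d : ℕ} (M : Matrix (Fin d) (Fin d) ℝ) (x : Vec d) : ℝ :=
  √(x.ofLp ⬝ᵥ (M *ᵥ x.ofLp))

/-- The regularised design matrix `V_t = ∑_{k=1}^{t-1} x_k x_kᵀ + lam • I`. -/
def design {d : ℕ} (lam : ℝ) (x : ℕ → Vec d) (t : ℕ) : Matrix (Fin d) (Fin d) ℝ :=
  ∑ k ∈ Finset.Ico 1 t, Matrix.vecMulVec (x k).ofLp (x k).ofLp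
    + lam • (1 : Matrix (Fin d) (Fin d) ℝ)

/-- The regularised least squares estimate `V_t⁻¹ ∑_{k=1}^{t-1} r_k x_k` from the actions `x_k` and
the observations `r_k`. -/
def ridge {d : ℕ} (lam : ℝ) (x : ℕ → Vec d) (r : ℕ → ℝ) (t : ℕ) : Vec d :=
  WithLp.toLp 2 ((design lam x t)⁻¹ *ᵥ ∑ k ∈ Finset.Ico 1 t, r k • (x k).ofLp)

/-- The confidence radius `β_t = ρ √(d log((1 + (t-1)/lam) / (δ/2))) + √lam * S`. -/
def beta (d : ℕ) (ρ δ lam S : ℝ) (t : ℕ) : ℝ :=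
  ρ * √(d * Real.log ((1 + ((t : ℝ) - 1) / lam) / (δ / 2))) + √lam * S

/-- The pessimistic action set `{x ∈ X : âᵀ x + β ‖x‖_{V⁻¹} ≤ b}`. -/
def pessimistic {d : ℕ} (X : Set (Vec d)) (b : ℝ) (ahat : Vec d) (β : ℝ)
    (V : Matrix (Fin d) (Fin d) ℝ) : Set (Vec d) :=
  {x ∈ X | inner ℝ ahat x + β * weightedNorm V⁻¹ x ≤ b}

/-- The optimistic action set `{x ∈ X : âᵀ x - β ‖x‖_{V⁻¹} ≤ b}`. -/
def optimistic {d : ℕ} (X : Set (Vec d)) (b : ℝ) (ahat : Vec d) (β : ℝ)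
    (V : Matrix (Fin d) (Fin d) ℝ) : Set (Vec d) :=
  {x ∈ X | inner ℝ ahat x - β * weightedNorm V⁻¹ x ≤ b}

/-- The scaling `min (ν / ‖x‖) 1`, where `ν / 0 = ∞`. -/
def normScale {d : ℕ} (ν : ℝ) (x : Vec d) : ℝ :=
  if ‖x‖ = 0 then 1 else min (ν / ‖x‖) 1

/-- One round of ROFUL. Given the set `X`, the limit `b`, the constant `ν`, the estimates
`thetahat` and `ahat`, the radius `β` and the matrix `V`, the action `x` may be played: it is
`γ • xt`, where `xt` maximises the upper confidence bound of the reward over the optimistic set,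
`m` is the largest scalar in `[0, 1]` for which `m • xt` is pessimistically safe, and
`γ = max (min (ν / ‖xt‖) 1) m`. -/
def IsROFULAction {d : ℕ} (X : Set (Vec d)) (b ν : ℝ) (thetahat ahat : Vec d) (β : ℝ)
    (V : Matrix (Fin d) (Fin d) ℝ) (x : Vec d) : Prop :=
  ∃ (xt : Vec d) (m : ℝ),
    IsArgmax (fun u => inner ℝ thetahat u + β * weightedNorm V⁻¹ u) (optimistic X b ahat β V) xt ∧
    IsGreatest {c : ℝ | c ∈ Set.Icc (0 : ℝ) 1 ∧ c • xt ∈ pessimistic X b ahat β V} m ∧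
    x = max (normScale ν xt) m • xt

/-- The actions `x 1, …, x T` are a run of ROFUL on the observed rewards `y` and constraint
observations `z`. -/
def IsROFULRun {d : ℕ} (X : Set (Vec d)) (b Sa Sθ ρ δ lam : ℝ) (T : ℕ)
    (x : ℕ → Vec d) (y z : ℕ → ℝ) : Prop :=
  ∀ t ∈ Finset.Icc 1 T,
    IsROFULAction X b (b / Sa) (ridge lam x y t) (ridge lam x z t)
      (beta d ρ δ lam (max Sa Sθ) t) (design lam x t) (x t)

/-- The σ-algebra generated by `x_1, ξ_1, …, x_{t-1}, ξ_{t-1}, x_t`. -/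
@[reducible]
def history {Ω : Type*} {d : ℕ} (x : ℕ → Ω → Vec d) (ξ : ℕ → Ω → ℝ) (t : ℕ) :
    MeasurableSpace Ω :=
  (⨆ k ∈ Finset.Icc 1 t, MeasurableSpace.comap (x k) inferInstance) ⊔
    (⨆ k ∈ Finset.Ico 1 t, MeasurableSpace.comap (ξ k) inferInstance)

/-- The noise `ξ_1, …, ξ_T` is centred and `ρ`-subgaussian conditionally on the history
`x_1, ξ_1, …, ξ_{t-1}, x_t`. -/
structure CondSubgaussian {Ω : Type*} [MeasurableSpace Ω] {d : ℕ} (μ : Measure Ω) (ρ : ℝ) (T : ℕ)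
    (x : ℕ → Ω → Vec d) (ξ : ℕ → Ω → ℝ) : Prop where
  measurable : ∀ t ∈ Finset.Icc 1 T, Measurable (ξ t)
  integrable_exp : ∀ t ∈ Finset.Icc 1 T, ∀ s : ℝ, Integrable (fun ω => Real.exp (s * ξ t ω)) μ
  condExp_eq_zero : ∀ t ∈ Finset.Icc 1 T, μ[ξ t | history x ξ t] =ᵐ[μ] 0
  condExp_exp_le : ∀ t ∈ Finset.Icc 1 T, ∀ s : ℝ,
    μ[fun ω => Real.exp (s * ξ t ω) | history x ξ t] ≤ᵐ[μ]
      fun _ => Real.exp (s ^ 2 * ρ ^ 2 / 2)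

/-- The constrained pseudo-regret `∑_{t=1}^T θᵀ (x⋆ - x_t)`. -/
def regret {d : ℕ} (θ xstar : Vec d) (x : ℕ → Vec d) (T : ℕ) : ℝ :=
  ∑ t ∈ Finset.Icc 1 T, inner ℝ θ (xstar - x t)

/-- The bound `2 ((Sθ + Sa) / b) β_T √(2 d T log(1 + T / (lam d)))`. -/
def regretBound (d : ℕ) (b Sa Sθ ρ δ lam : ℝ) (T : ℕ) : ℝ :=
  2 * ((Sθ + Sa) / b) * beta d ρ δ lam (max Sa Sθ) T *
    √(2 * d * T * Real.log (1 + T / (lam * d)))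

end SafeBandit

end

/-! Suppose that for every `u` and every round both ridge estimates err in direction `u` by at most
`β‖u‖_{V⁻¹}`. The rest is then deterministic. The played action either has norm at most `b / Sa`,
where Cauchy–Schwarz gives safety, or is pessimistically safe (`IsROFULAction.mem_feasible`). For
the regret, `xstar` lies in the optimistic set, so the optimistic maximiser `xt` falls short of it
by at most `2β‖xt‖_{V⁻¹}`. Shrinking `xt` by `b / (b + 2β‖xt‖_{V⁻¹})` already makes it
pessimistically safe, so the loss from scaling is controlled by the same norm. Both losses become
multiples of the norm of the played action (`IsROFULAction.regret_le`), and these norms are summed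
by Cauchy–Schwarz and the elliptical potential bound `sum_sq_weightedNorm_le`.

The confidence event comes from the method of mixtures. Let `S_t` be the score of the noise divided
by `ρ`. Averaging `exp(Z·S_t - ∑ (Z·x_k)² / 2)` over `Z ~ N(0, I/lam)` gives `mixture`. No
`d`-dimensional integral is needed: under the law of `Z` reweighted by the past, `Z·x_t` is a scalar
Gaussian, so each step of the supermartingale is one scalar Gaussian average
(`lintegral_mul_gaussian_mixture_le`). Ville's inequality makes the bound uniform in time. Each of
the two noises costs probability `δ / 2`. -/

namespace Matrix

/-! ### Quadratic forms and rank-one updates of positive definite matrices -/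

section QuadraticForm

variable {n : Type*} [Fintype n]

lemma IsHermitian.dotProduct_mulVec_comm {W : Matrix n n ℝ} (hW : W.IsHermitian) (x y : n → ℝ) :
    x ⬝ᵥ (W *ᵥ y) = y ⬝ᵥ (W *ᵥ x) := by
  have h : Wᵀ = W := by simpa [Matrix.IsHermitian, Matrix.conjTranspose_eq_transpose_of_trivial] using hW
  rw [Matrix.dotProduct_mulVec, ← Matrix.mulVec_transpose, h, dotProduct_comm]

lemma PosSemidef.dotProduct_mulVec_self_nonneg {W : Matrix n n ℝ} (hW : W.PosSemidef)
    (x : n → ℝ) : 0 ≤ x ⬝ᵥ (W *ᵥ x) := by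
  simpa using hW.dotProduct_mulVec_nonneg x

/-- Cauchy–Schwarz for a possibly degenerate form: the quadratic `c ↦ (x + c y)ᵀ W (x + c y)` is
nonnegative, so its discriminant is not positive. -/
lemma PosSemidef.sq_dotProduct_mulVec_le {W : Matrix n n ℝ} (hW : W.PosSemidef) (x y : n → ℝ) :
    (x ⬝ᵥ (W *ᵥ y)) ^ 2 ≤ (x ⬝ᵥ (W *ᵥ x)) * (y ⬝ᵥ (W *ᵥ y)) := by
  have key : ∀ c : ℝ, 0 ≤ (y ⬝ᵥ (W *ᵥ y)) * (c * c) + (2 * (x ⬝ᵥ (W *ᵥ y))) * c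
      + x ⬝ᵥ (W *ᵥ x) := by
    intro c
    have h := PosSemidef.dotProduct_mulVec_self_nonneg hW (x + c • y)
    simp only [Matrix.mulVec_add, Matrix.mulVec_smul, add_dotProduct, dotProduct_add,
      smul_dotProduct, dotProduct_smul, smul_eq_mul,
      IsHermitian.dotProduct_mulVec_comm hW.isHermitian y x] at h
    linarith
  have h := discrim_le_zero key
  rw [discrim] at h
  linarith

lemma PosDef.add_vecMulVec {V : Matrix n n ℝ} (hV : V.PosDef) (x : n → ℝ) :
    (V + Matrix.vecMulVec x x).PosDef :=
  hV.add_posSemidef (by simpa using Matrix.posSemidef_vecMulVec_self_star x)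

variable [DecidableEq n]

lemma PosDef.inv_mulVec_eq {V : Matrix n n ℝ} (hV : V.PosDef) {x y : n → ℝ} (h : V *ᵥ x = y) :
    V⁻¹ *ᵥ y = x := by
  rw [← h, Matrix.mulVec_mulVec, Matrix.nonsing_inv_mul _ hV.det_pos.ne'.isUnit, Matrix.one_mulVec]

lemma PosDef.mulVec_inv_mulVec {V : Matrix n n ℝ} (hV : V.PosDef) (y : n → ℝ) :
    V *ᵥ (V⁻¹ *ᵥ y) = y := by
  rw [Matrix.mulVec_mulVec, Matrix.mul_nonsing_inv _ hV.det_pos.ne'.isUnit, Matrix.one_mulVec]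

/-- Rank-one update of the inverse quadratic form (Sherman–Morrison). -/
lemma PosDef.inv_quadratic_update {V : Matrix n n ℝ} (hV : V.PosDef) (S x : n → ℝ) (e : ℝ) :
    (S + e • x) ⬝ᵥ ((V + Matrix.vecMulVec x x)⁻¹ *ᵥ (S + e • x)) =
      S ⬝ᵥ (V⁻¹ *ᵥ S) + (2 * e * (x ⬝ᵥ (V⁻¹ *ᵥ S)) + e ^ 2 * (x ⬝ᵥ (V⁻¹ *ᵥ x))
        - (x ⬝ᵥ (V⁻¹ *ᵥ S)) ^ 2) / (1 + x ⬝ᵥ (V⁻¹ *ᵥ x)) := by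
  have hu : 0 ≤ x ⬝ᵥ (V⁻¹ *ᵥ x) :=
    PosSemidef.dotProduct_mulVec_self_nonneg hV.inv.posSemidef x
  have hsymm := IsHermitian.dotProduct_mulVec_comm hV.inv.isHermitian S x
  have hp := PosDef.mulVec_inv_mulVec hV S
  have hq := PosDef.mulVec_inv_mulVec hV x
  set p := V⁻¹ *ᵥ S
  set q := V⁻¹ *ᵥ x
  set u := x ⬝ᵥ q
  have hu1 : 1 + u ≠ 0 := by positivity
  -- The updated linear system is solved explicitly by a correction of `p` along `q`, which avoids a
  -- formula for the inverse matrix itself.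
  have hsolve : (V + Matrix.vecMulVec x x) *ᵥ (p + ((e - x ⬝ᵥ p) / (1 + u)) • q) = S + e • x := by
    simp only [Matrix.mulVec_add, Matrix.add_mulVec, Matrix.mulVec_smul, Matrix.vecMulVec_mulVec,
      hp, hq]
    ext i
    simp only [Pi.add_apply, Pi.smul_apply, smul_eq_mul, MulOpposite.smul_eq_mul_unop,
      MulOpposite.unop_op]
    change S i + x i * (x ⬝ᵥ p) + (e - x ⬝ᵥ p) / (1 + u) * (x i + x i * u) = S i + e * x i
    field_simp
    ring
  rw [PosDef.inv_mulVec_eq (PosDef.add_vecMulVec hV x) hsolve]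
  simp only [add_dotProduct, dotProduct_add, smul_dotProduct, dotProduct_smul, smul_eq_mul, hsymm]
  change S ⬝ᵥ p + e * (x ⬝ᵥ p) + ((e - x ⬝ᵥ p) / (1 + u) * (x ⬝ᵥ p + e * u)) = _
  field_simp
  ring

lemma PosDef.det_add_vecMulVec {V : Matrix n n ℝ} (hV : V.PosDef) (x : n → ℝ) :
    (V + Matrix.vecMulVec x x).det = V.det * (1 + x ⬝ᵥ (V⁻¹ *ᵥ x)) := by
  rw [Matrix.vecMulVec_eq Unit,
    Matrix.det_add_replicateCol_mul_replicateRow hV.det_pos.ne'.isUnit]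
  congr 2
  rw [Matrix.det_unique]
  simp [Matrix.mul_apply, dotProduct, Matrix.mulVec, Finset.sum_mul, Finset.mul_sum]
  rw [Finset.sum_comm]
  simp [mul_assoc]

/-- The arithmetic-geometric mean inequality for the eigenvalues of a matrix. -/
lemma PosDef.det_le_trace_div_pow [Nonempty n] {V : Matrix n n ℝ} (hV : V.PosDef) :
    V.det ≤ (V.trace / Fintype.card n) ^ Fintype.card n := by
  have hcard : (0 : ℝ) < Fintype.card n := by exact_mod_cast Fintype.card_pos
  have h := Real.geom_mean_le_arith_mean Finset.univ (fun _ : n => (1 : ℝ))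
    hV.isHermitian.eigenvalues (by simp) (by simpa using hcard)
    (fun i _ => (hV.eigenvalues_pos i).le)
  have hprod : 0 ≤ ∏ i, hV.isHermitian.eigenvalues i :=
    Finset.prod_nonneg fun i _ => (hV.eigenvalues_pos i).le
  simp only [Real.rpow_one, Finset.sum_const, Finset.card_univ, nsmul_eq_mul, mul_one,
    one_mul] at h
  rw [hV.isHermitian.det_eq_prod_eigenvalues, hV.isHermitian.trace_eq_sum_eigenvalues]
  simp only [RCLike.ofReal_real_eq_id, id_eq]
  calc ∏ i, hV.isHermitian.eigenvalues i
      = ((∏ i, hV.isHermitian.eigenvalues i) ^ ((Fintype.card n : ℝ)⁻¹)) ^ Fintype.card n := by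
        rw [Real.rpow_inv_natCast_pow hprod Fintype.card_ne_zero]
    _ ≤ _ := pow_le_pow_left₀ (Real.rpow_nonneg hprod _) h _

/-- With `w = V⁻¹ x`, the hypothesis gives `c |w|² ≤ w·x`. Inserting this into `|x - c w|² ≥ 0`
leaves `c (w·x) ≤ |x|²`. -/
lemma sub_smul_one_posSemidef_inv_quadratic_le {V : Matrix n n ℝ} {c : ℝ} (hc : 0 < c)
    (hV : (V - c • (1 : Matrix n n ℝ)).PosSemidef) (x : n → ℝ) :
    x ⬝ᵥ (V⁻¹ *ᵥ x) ≤ (x ⬝ᵥ x) / c := by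
  have hVd : V.PosDef := by
    simpa using (Matrix.PosDef.one.smul hc).posSemidef_add hV
  have h1 := PosDef.mulVec_inv_mulVec hVd x
  set w := V⁻¹ *ᵥ x
  have h2 := PosSemidef.dotProduct_mulVec_self_nonneg hV w
  rw [Matrix.sub_mulVec, Matrix.smul_mulVec, Matrix.one_mulVec, h1, dotProduct_sub,
    dotProduct_smul, smul_eq_mul, dotProduct_comm] at h2
  have h3 : 0 ≤ (x - c • w) ⬝ᵥ (x - c • w) := dotProduct_self_star_nonneg _
  simp only [sub_dotProduct, dotProduct_sub, smul_dotProduct, dotProduct_smul, smul_eq_mul,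
    dotProduct_comm w x] at h3
  rw [le_div_iff₀ hc]
  nlinarith

end QuadraticForm

end Matrix

/-! ### The design matrix and the elliptical potential -/

namespace SafeBandit

variable {d : ℕ} {lam : ℝ}

lemma design_one (lam : ℝ) (x : ℕ → Vec d) :
    design lam x 1 = lam • (1 : Matrix (Fin d) (Fin d) ℝ) := by
  simp [design]

lemma design_succ (lam : ℝ) (x : ℕ → Vec d) {t : ℕ} (ht : 1 ≤ t) :
    design lam x (t + 1) = design lam x t + Matrix.vecMulVec (x t).ofLp (x t).ofLp := by
  rw [design, design, Finset.sum_Ico_succ_top ht]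
  abel

lemma design_sub_smul_one_posSemidef (lam : ℝ) (x : ℕ → Vec d) (t : ℕ) :
    (design lam x t - lam • (1 : Matrix (Fin d) (Fin d) ℝ)).PosSemidef := by
  rw [design, add_sub_cancel_right]
  exact Matrix.posSemidef_sum _ fun k _ => by
    simpa using Matrix.posSemidef_vecMulVec_self_star (x k).ofLp

lemma design_posDef (hlam : 0 < lam) (x : ℕ → Vec d) (t : ℕ) : (design lam x t).PosDef := by
  simpa using (Matrix.PosDef.one.smul hlam).posSemidef_add (design_sub_smul_one_posSemidef lam x t)

lemma inner_eq_dotProduct (x y : Vec d) : inner ℝ x y = x.ofLp ⬝ᵥ y.ofLp := by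
  rw [EuclideanSpace.inner_eq_star_dotProduct, star_trivial, dotProduct_comm]

lemma dotProduct_self_eq_norm_sq (x : Vec d) : x.ofLp ⬝ᵥ x.ofLp = ‖x‖ ^ 2 := by
  rw [← inner_eq_dotProduct, real_inner_self_eq_norm_sq]

lemma weightedNorm_nonneg (M : Matrix (Fin d) (Fin d) ℝ) (x : Vec d) : 0 ≤ weightedNorm M x :=
  Real.sqrt_nonneg _

lemma sq_weightedNorm {M : Matrix (Fin d) (Fin d) ℝ} (hM : M.PosSemidef) (x : Vec d) :
    weightedNorm M x ^ 2 = x.ofLp ⬝ᵥ (M *ᵥ x.ofLp) :=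
  Real.sq_sqrt (Matrix.PosSemidef.dotProduct_mulVec_self_nonneg hM _)

lemma weightedNorm_smul (M : Matrix (Fin d) (Fin d) ℝ) {c : ℝ} (hc : 0 ≤ c) (x : Vec d) :
    weightedNorm M (c • x) = c * weightedNorm M x := by
  rw [weightedNorm, weightedNorm, WithLp.ofLp_smul, Matrix.mulVec_smul, smul_dotProduct,
    dotProduct_smul, smul_eq_mul, smul_eq_mul, ← mul_assoc, Real.sqrt_mul (mul_self_nonneg c),
    Real.sqrt_mul_self hc]

lemma abs_dotProduct_mulVec_le {M : Matrix (Fin d) (Fin d) ℝ} (hM : M.PosSemidef) (x y : Vec d) :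
    |x.ofLp ⬝ᵥ (M *ᵥ y.ofLp)| ≤ weightedNorm M x * weightedNorm M y := by
  apply abs_le_of_sq_le_sq _ (mul_nonneg (weightedNorm_nonneg _ _) (weightedNorm_nonneg _ _))
  rw [mul_pow, sq_weightedNorm hM, sq_weightedNorm hM]
  exact hM.sq_dotProduct_mulVec_le _ _

lemma sq_weightedNorm_design_inv_le (hlam : 0 < lam) (x : ℕ → Vec d) (t : ℕ) (u : Vec d) :
    weightedNorm (design lam x t)⁻¹ u ^ 2 ≤ ‖u‖ ^ 2 / lam := by
  rw [sq_weightedNorm (design_posDef hlam x t).inv.posSemidef, ← dotProduct_self_eq_norm_sq]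
  exact Matrix.sub_smul_one_posSemidef_inv_quadratic_le hlam
    (design_sub_smul_one_posSemidef lam x t) _

lemma trace_design (lam : ℝ) (x : ℕ → Vec d) (t : ℕ) :
    (design lam x t).trace = ∑ k ∈ Finset.Ico 1 t, ‖x k‖ ^ 2 + lam * d := by
  simp [design, Matrix.trace_sum, Matrix.trace_vecMulVec, dotProduct_self_eq_norm_sq]

/-- The determinant is bounded through the trace by AM-GM, and each action of norm at most one adds
at most one to the trace. -/
lemma log_det_design_le (hd : 0 < d) (hlam : 0 < lam) {x : ℕ → Vec d} {t : ℕ} (ht : 1 ≤ t)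
    (hx : ∀ k ∈ Finset.Ico 1 t, ‖x k‖ ≤ 1) :
    Real.log ((design lam x t).det / lam ^ d) ≤ d * Real.log (1 + (t - 1) / (lam * d)) := by
  have hV := design_posDef hlam x t
  have : Nonempty (Fin d) := ⟨⟨0, hd⟩⟩
  have hd' : (0 : ℝ) < d := by exact_mod_cast hd
  have htr : (design lam x t).trace ≤ (t - 1) + lam * d := by
    rw [trace_design]
    gcongr
    calc ∑ k ∈ Finset.Ico 1 t, ‖x k‖ ^ 2 ≤ ∑ k ∈ Finset.Ico 1 t, (1 : ℝ) :=
          Finset.sum_le_sum fun k hk => pow_le_one₀ (norm_nonneg _) (hx k hk)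
      _ = t - 1 := by simp [Nat.cast_sub ht]
  have htr0 : 0 ≤ (design lam x t).trace := hV.posSemidef.trace_nonneg
  have hdet := hV.det_le_trace_div_pow
  rw [Fintype.card_fin] at hdet
  rw [← Real.log_pow]
  apply Real.log_le_log (div_pos hV.det_pos (by positivity))
  rw [div_le_iff₀ (by positivity), ← mul_pow]
  refine hdet.trans (pow_le_pow_left₀ (by positivity) ?_ _)
  rw [div_le_iff₀ hd']
  refine htr.trans (le_of_eq ?_)
  field_simp
  ring

/-- Telescoping: round `t` multiplies the determinant by `1 + ‖x_t‖²_{V_t⁻¹}`, starting from `lam ^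
d`. -/
lemma sum_log_one_add_sq_weightedNorm (hlam : 0 < lam) (x : ℕ → Vec d) (T : ℕ) :
    ∑ t ∈ Finset.Icc 1 T, Real.log (1 + weightedNorm (design lam x t)⁻¹ (x t) ^ 2) =
      Real.log ((design lam x (T + 1)).det / lam ^ d) := by
  induction T with
  | zero => simp [design_one, hlam.ne']
  | succ T ih =>
    have hV := design_posDef hlam x (T + 1)
    rw [Finset.sum_Icc_succ_top (by omega), ih, design_succ lam x (by omega : 1 ≤ T + 1),
      hV.det_add_vecMulVec, sq_weightedNorm hV.inv.posSemidef, mul_div_right_comm,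
      Real.log_mul (div_pos hV.det_pos (by positivity)).ne']
    have := hV.inv.posSemidef.dotProduct_mulVec_self_nonneg (x (T + 1)).ofLp
    positivity

/-- The elliptical potential bound. -/
lemma sum_sq_weightedNorm_le (hd : 0 < d) (hlam : 1 ≤ lam) {x : ℕ → Vec d} {T : ℕ}
    (hx : ∀ t ∈ Finset.Icc 1 T, ‖x t‖ ≤ 1) :
    ∑ t ∈ Finset.Icc 1 T, weightedNorm (design lam x t)⁻¹ (x t) ^ 2 ≤
      2 * d * Real.log (1 + T / (lam * d)) := by
  have hlam0 : 0 < lam := by linarith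
  have hlog := log_det_design_le hd hlam0 (t := T + 1) (by omega)
    (fun k hk => hx k (by simp only [Finset.mem_Ico, Finset.mem_Icc] at hk ⊢; omega))
  rw [← sum_log_one_add_sq_weightedNorm hlam0] at hlog
  push_cast at hlog
  rw [add_sub_cancel_right] at hlog
  calc ∑ t ∈ Finset.Icc 1 T, weightedNorm (design lam x t)⁻¹ (x t) ^ 2
      ≤ ∑ t ∈ Finset.Icc 1 T, 2 * Real.log (1 + weightedNorm (design lam x t)⁻¹ (x t) ^ 2) := by
        refine Finset.sum_le_sum fun t ht => ?_
        have h0 := sq_nonneg (weightedNorm (design lam x t)⁻¹ (x t))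
        have h1 : weightedNorm (design lam x t)⁻¹ (x t) ^ 2 ≤ 1 := by
          refine (sq_weightedNorm_design_inv_le hlam0 x t (x t)).trans ?_
          rw [div_le_one hlam0]
          exact (pow_le_one₀ (norm_nonneg _) (hx t ht)).trans hlam
        have h2 := Real.le_log_one_add_of_nonneg h0
        set u := weightedNorm (design lam x t)⁻¹ (x t) ^ 2
        -- Together with `h2` this gives `u ≤ 2 log (1 + u)`; it uses `u ≤ 1`, which is where `lam ≥
        -- 1` and the unit ball enter.
        have h3 : u / 2 ≤ 2 * u / (u + 2) := by
          rw [div_le_div_iff₀ (by norm_num) (by positivity)]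
          nlinarith
        linarith
    _ = 2 * ∑ t ∈ Finset.Icc 1 T, Real.log (1 + weightedNorm (design lam x t)⁻¹ (x t) ^ 2) := by
        rw [Finset.mul_sum]
    _ ≤ _ := by linarith

end SafeBandit

/-! ### Gaussian mixtures of exponential moments and Ville's inequality -/

/-- Averaging `exp (e * g - g ^ 2 / 2)` over a Gaussian `g` with mean `s` and variance `u`. -/
lemma ProbabilityTheory.lintegral_exp_mul_sub_sq_gaussianReal (e s : ℝ) {u : ℝ} (hu : 0 ≤ u) :
    ∫⁻ z, ENNReal.ofReal (Real.exp (e * (s + √u * z) - (s + √u * z) ^ 2 / 2))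
        ∂gaussianReal 0 1 =
      ENNReal.ofReal ((√(1 + u))⁻¹ *
        Real.exp ((2 * e * s + e ^ 2 * u - s ^ 2) / (1 + u) / 2)) := by
  have hu1 : (0 : ℝ) < 1 + u := by linarith
  let v : NNReal := ⟨(1 + u)⁻¹, by positivity⟩
  have hvr : (v : ℝ) = (1 + u)⁻¹ := rfl
  have hv : v ≠ 0 := fun h => (inv_pos.2 hu1).ne' (by rw [← hvr, h]; rfl)
  rw [gaussianReal_of_var_ne_zero 0 one_ne_zero, lintegral_withDensity_eq_lintegral_mul _
    (measurable_gaussianPDF 0 1) (by fun_prop)]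
  have key : ∀ z : ℝ, (gaussianPDF 0 1 * fun z => ENNReal.ofReal
      (Real.exp (e * (s + √u * z) - (s + √u * z) ^ 2 / 2))) z =
      ENNReal.ofReal ((√(1 + u))⁻¹ * Real.exp ((2 * e * s + e ^ 2 * u - s ^ 2) / (1 + u) / 2)) *
        gaussianPDF ((e - s) * √u / (1 + u)) v z := by
    intro z
    have hsq : √u ^ 2 = u := Real.sq_sqrt hu
    rw [Pi.mul_apply, gaussianPDF, gaussianPDF, ← ENNReal.ofReal_mul (gaussianPDFReal_nonneg _ _ _),
      ← ENNReal.ofReal_mul (by positivity)]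
    congr 1
    rw [gaussianPDFReal_def, gaussianPDFReal_def]
    simp only [hvr, NNReal.coe_one]
    have h1 : √(2 * Real.pi * (1 + u)⁻¹) = √(2 * Real.pi) * (√(1 + u))⁻¹ := by
      rw [Real.sqrt_mul (by positivity), Real.sqrt_inv]
    rw [h1, mul_one]
    have h2 : (0 : ℝ) < √(1 + u) := Real.sqrt_pos.2 hu1
    have h3 : (0 : ℝ) < √(2 * Real.pi) := by positivity
    have h4 : ∀ A B C D : ℝ, A + B = C + D → (√(2 * Real.pi))⁻¹ * Real.exp A * Real.exp B =
        (√(1 + u))⁻¹ * Real.exp C * ((√(2 * Real.pi) * (√(1 + u))⁻¹)⁻¹ * Real.exp D) := by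
      intro A B C D h
      rw [mul_assoc, ← Real.exp_add, h, Real.exp_add]
      field_simp
    apply h4
    -- Replacing `u` by `w ^ 2` turns the identity of exponents into one of rational functions.
    generalize √u = w at hsq
    subst hsq
    field_simp
    ring
  simp_rw [key]
  rw [lintegral_const_mul _ (measurable_gaussianPDF _ _), lintegral_gaussianPDF_eq_one _ hv,
    mul_one]

namespace MeasureTheory

section Subgaussian

variable {Ω : Type*} {m m0 : MeasurableSpace Ω} {μ : Measure Ω}

/-- Trades the conditional expectation for integrals over sets of `m`, so that later steps work with
nonnegative integrals and need no integrability. -/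
lemma setLIntegral_ofReal_le_of_condExp_le [IsFiniteMeasure μ] (hm : m ≤ m0) {f : Ω → ℝ} {c : ℝ}
    (hf : Integrable f μ) (hf0 : 0 ≤ f) (hc : 0 ≤ c) (h : μ[f | m] ≤ᵐ[μ] fun _ => c)
    {A : Set Ω} (hA : MeasurableSet[m] A) :
    ∫⁻ ω in A, ENNReal.ofReal (f ω) ∂μ ≤ ENNReal.ofReal c * μ A := by
  rw [← ofReal_integral_eq_lintegral_ofReal hf.integrableOn (Filter.Eventually.of_forall hf0),
    ← setIntegral_condExp hm hf hA]
  calc ENNReal.ofReal (∫ ω in A, (μ[f | m]) ω ∂μ) ≤ ENNReal.ofReal (∫ ω in A, c ∂μ) :=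
        ENNReal.ofReal_le_ofReal (setIntegral_mono_ae integrable_condExp.integrableOn
          (integrable_const c).integrableOn h)
    _ = ENNReal.ofReal c * μ A := by
        rw [setIntegral_const, smul_eq_mul, mul_comm, ENNReal.ofReal_mul hc,
          ofReal_measureReal]

/-- A weight `w` whose integral over each set of `m` is at most the measure of the set also
decreases the integral of each `m`-measurable function. -/
lemma lintegral_mul_le_of_setLIntegral_le (hm : m ≤ m0) {w Y : Ω → ENNReal}
    (hw : Measurable w) (hY : Measurable[m] Y)
    (h : ∀ A, MeasurableSet[m] A → ∫⁻ ω in A, w ω ∂μ ≤ μ A) :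
    ∫⁻ ω, Y ω * w ω ∂μ ≤ ∫⁻ ω, Y ω ∂μ := by
  -- The hypothesis is a comparison of two measures on `m`, and `Y` is integrated on `m` only.
  have hle : (μ.withDensity w).trim hm ≤ μ.trim hm := by
    refine Measure.le_iff.2 fun A hA => ?_
    rw [trim_measurableSet_eq hm hA, trim_measurableSet_eq hm hA, withDensity_apply _ (hm A hA)]
    exact h A hA
  calc ∫⁻ ω, Y ω * w ω ∂μ = ∫⁻ ω, Y ω ∂(μ.withDensity w) := by
        rw [lintegral_withDensity_eq_lintegral_mul _ hw (hY.mono hm le_rfl)]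
        simp [mul_comm]
    _ = ∫⁻ ω, Y ω ∂((μ.withDensity w).trim hm) := (lintegral_trim hm hY).symm
    _ ≤ ∫⁻ ω, Y ω ∂(μ.trim hm) := lintegral_mono' hle le_rfl
    _ = ∫⁻ ω, Y ω ∂μ := lintegral_trim hm hY

/-- A conditional exponential moment bound at all constants extends to random multipliers that are
measurable with respect to the conditioning σ-algebra. -/
lemma lintegral_mul_exp_mul_sub_sq_le (hm : m ≤ m0) {ξ g : Ω → ℝ} {Y : Ω → ENNReal}
    (hξ : Measurable ξ) (hg : Measurable[m] g) (hY : Measurable[m] Y)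
    (h : ∀ (c : ℝ) (A : Set Ω), MeasurableSet[m] A →
      ∫⁻ ω in A, ENNReal.ofReal (Real.exp (c * ξ ω - c ^ 2 / 2)) ∂μ ≤ μ A) :
    ∫⁻ ω, Y ω * ENNReal.ofReal (Real.exp (g ω * ξ ω - g ω ^ 2 / 2)) ∂μ ≤ ∫⁻ ω, Y ω ∂μ := by
  -- A simple multiplier is constant on each of finitely many fibres in `m`, where the hypothesis at
  -- that constant applies to `Y` cut off to the fibre.
  have hsimple : ∀ G : @SimpleFunc Ω m ℝ,
      ∫⁻ ω, Y ω * ENNReal.ofReal (Real.exp (G ω * ξ ω - G ω ^ 2 / 2)) ∂μ ≤ ∫⁻ ω, Y ω ∂μ := by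
    intro G
    have hdecomp : ∀ F : Ω → ENNReal, ∀ ω,
        F ω = ∑ c ∈ @SimpleFunc.range Ω ℝ m G, (G ⁻¹' {c}).indicator F ω := by
      intro F ω
      rw [Finset.sum_eq_single (G ω)]
      · simp
      · intro c _ hc
        exact Set.indicator_of_notMem (fun h' => hc (by simpa using h'.symm)) _
      · intro h'
        exact absurd (@SimpleFunc.mem_range_self Ω ℝ m G ω) h'
    have hGm : ∀ c, MeasurableSet[m] (G ⁻¹' {c}) := fun c => @SimpleFunc.measurableSet_fiber Ω ℝ m G c
    rw [lintegral_congr (hdecomp fun ω => Y ω * ENNReal.ofReal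
      (Real.exp (G ω * ξ ω - G ω ^ 2 / 2))), lintegral_congr (hdecomp Y)]
    have hYm : Measurable Y := hY.mono hm le_rfl
    have hG' : Measurable G := (@SimpleFunc.measurable Ω ℝ m _ G).mono hm le_rfl
    rw [lintegral_finsetSum _ fun c _ => Measurable.indicator (by fun_prop) (hm _ (hGm c)),
      lintegral_finsetSum _ fun c _ => hYm.indicator (hm _ (hGm c))]
    refine Finset.sum_le_sum fun c _ => ?_
    refine le_trans (le_of_eq (lintegral_congr fun ω => ?_))
      (lintegral_mul_le_of_setLIntegral_le hm (w := fun ω => ENNReal.ofReal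
        (Real.exp (c * ξ ω - c ^ 2 / 2))) (by fun_prop) (hY.indicator (hGm c)) (h c))
    by_cases hω : ω ∈ G ⁻¹' {c}
    · simp only [Set.indicator_of_mem hω]
      rw [show G ω = c by simpa using hω]
    · simp [Set.indicator_of_notMem hω]
  have hgs : StronglyMeasurable[m] g := hg.stronglyMeasurable
  have hg0 : Measurable g := hg.mono hm le_rfl
  have hYm : Measurable Y := hY.mono hm le_rfl
  -- Pointwise convergence is enough, because Fatou's lemma gives the inequality in the needed
  -- direction.
  have hlim : ∀ ω, Filter.Tendsto (fun n => Y ω * ENNReal.ofReal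
      (Real.exp (hgs.approx n ω * ξ ω - hgs.approx n ω ^ 2 / 2))) Filter.atTop
      (nhds (Y ω * ENNReal.ofReal (Real.exp (g ω * ξ ω - g ω ^ 2 / 2)))) := by
    intro ω
    have h1 := hgs.tendsto_approx ω
    have h2 : Continuous fun r : ℝ => ENNReal.ofReal (Real.exp (r * ξ ω - r ^ 2 / 2)) :=
      ENNReal.continuous_ofReal.comp (by fun_prop)
    refine ENNReal.Tendsto.const_mul ((h2.tendsto _).comp h1) (Or.inl ?_)
    simpa using Real.exp_pos _
  calc ∫⁻ ω, Y ω * ENNReal.ofReal (Real.exp (g ω * ξ ω - g ω ^ 2 / 2)) ∂μ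
      = ∫⁻ ω, Filter.liminf (fun n => Y ω * ENNReal.ofReal
          (Real.exp (hgs.approx n ω * ξ ω - hgs.approx n ω ^ 2 / 2))) Filter.atTop ∂μ :=
        lintegral_congr fun ω => (hlim ω).liminf_eq.symm
    _ ≤ Filter.liminf (fun n => ∫⁻ ω, Y ω * ENNReal.ofReal
          (Real.exp (hgs.approx n ω * ξ ω - hgs.approx n ω ^ 2 / 2)) ∂μ) Filter.atTop := by
        refine lintegral_liminf_le fun n => ?_
        have : Measurable (hgs.approx n) :=
          (@SimpleFunc.measurable Ω ℝ m _ (hgs.approx n)).mono hm le_rfl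
        fun_prop
    _ ≤ ∫⁻ ω, Y ω ∂μ := by
        refine (Filter.liminf_le_liminf (Filter.Eventually.of_forall fun n =>
          hsimple (hgs.approx n))).trans ?_
        simp

/-- The Gaussian mixture of conditional exponential moment bounds. -/
lemma lintegral_mul_gaussian_mixture_le [SFinite μ] (hm : m ≤ m0) {ξ s u : Ω → ℝ}
    {Y : Ω → ENNReal} (hξ : Measurable ξ) (hs : Measurable[m] s) (hu : Measurable[m] u)
    (hu0 : ∀ ω, 0 ≤ u ω) (hY : Measurable[m] Y)
    (h : ∀ (c : ℝ) (A : Set Ω), MeasurableSet[m] A →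
      ∫⁻ ω in A, ENNReal.ofReal (Real.exp (c * ξ ω - c ^ 2 / 2)) ∂μ ≤ μ A) :
    ∫⁻ ω, Y ω * ENNReal.ofReal ((√(1 + u ω))⁻¹ * Real.exp
        ((2 * ξ ω * s ω + ξ ω ^ 2 * u ω - s ω ^ 2) / (1 + u ω) / 2)) ∂μ ≤ ∫⁻ ω, Y ω ∂μ := by
  have hs0 : Measurable s := hs.mono hm le_rfl
  have hu' : Measurable u := hu.mono hm le_rfl
  have hY' : Measurable Y := hY.mono hm le_rfl
  calc ∫⁻ ω, Y ω * ENNReal.ofReal ((√(1 + u ω))⁻¹ * Real.exp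
        ((2 * ξ ω * s ω + ξ ω ^ 2 * u ω - s ω ^ 2) / (1 + u ω) / 2)) ∂μ
      = ∫⁻ ω, ∫⁻ z, Y ω * ENNReal.ofReal (Real.exp ((s ω + √(u ω) * z) * ξ ω
          - (s ω + √(u ω) * z) ^ 2 / 2)) ∂ProbabilityTheory.gaussianReal 0 1 ∂μ := by
        refine lintegral_congr fun ω => ?_
        rw [← ProbabilityTheory.lintegral_exp_mul_sub_sq_gaussianReal _ _ (hu0 ω),
          lintegral_const_mul _ (by fun_prop)]
        simp_rw [mul_comm (ξ ω)]
    _ = ∫⁻ z, ∫⁻ ω, Y ω * ENNReal.ofReal (Real.exp ((s ω + √(u ω) * z) * ξ ω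
          - (s ω + √(u ω) * z) ^ 2 / 2)) ∂μ ∂ProbabilityTheory.gaussianReal 0 1 :=
        lintegral_lintegral_swap (by fun_prop)
    -- For fixed `z` the multiplier `s + √u z` is measurable with respect to `m`.
    _ ≤ ∫⁻ _, ∫⁻ ω, Y ω ∂μ ∂ProbabilityTheory.gaussianReal 0 1 := by
        refine lintegral_mono fun z => lintegral_mul_exp_mul_sub_sq_le hm hξ ?_ hY h
        exact hs.add (hu.sqrt.mul_const z)
    _ = ∫⁻ ω, Y ω ∂μ := by simp

/-- Ville's inequality on a finite horizon. -/
lemma measure_exists_ge_le_of_setLIntegral_succ_le {F : ℕ → MeasurableSpace Ω} {T : ℕ}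
    (hF : ∀ t ∈ Finset.Icc 1 T, F t ≤ m0) (hmono : Monotone F) {M : ℕ → Ω → ENNReal}
    (hM : ∀ t ∈ Finset.Icc 1 T, Measurable[F t] (M t)) (h1 : ∫⁻ ω, M 1 ω ∂μ ≤ 1)
    (hstep : ∀ t ∈ Finset.Ico 1 T, ∀ A, MeasurableSet[F t] A →
      ∫⁻ ω in A, M (t + 1) ω ∂μ ≤ ∫⁻ ω in A, M t ω ∂μ) (c : ENNReal) :
    c * μ {ω | ∃ t ∈ Finset.Icc 1 T, c ≤ M t ω} ≤ 1 := by
  set B : ℕ → Set Ω := fun n => {ω | ∃ t ∈ Finset.Icc 1 n, c ≤ M t ω} with hB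
  have hcm : ∀ t ∈ Finset.Icc 1 T, MeasurableSet[F t] {ω | c ≤ M t ω} := fun t ht =>
    hM t ht measurableSet_Ici
  have hBm : ∀ n ∈ Finset.Icc 1 T, MeasurableSet[F n] (B n) := by
    intro n hn
    have : B n = ⋃ t ∈ Finset.Icc 1 n, {ω | c ≤ M t ω} := by ext; simp [hB]
    rw [this]
    refine Finset.measurableSet_biUnion _ fun t ht => ?_
    simp only [Finset.mem_Icc] at ht hn
    exact hmono ht.2 _ (hcm t (Finset.mem_Icc.2 ⟨ht.1, by omega⟩))
  have hB0 : B 0 = ∅ := by ext; simp [hB]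
  have hBm0 : ∀ n ≤ T, MeasurableSet (B n) := by
    intro n hn
    rcases Nat.eq_zero_or_pos n with rfl | h
    · rw [hB0]; exact MeasurableSet.empty
    · have h' := Finset.mem_Icc.2 ⟨h, hn⟩
      exact hF n h' _ (hBm n h')
  have hBsucc : ∀ n, B (n + 1) = B n ∪ ((B n)ᶜ ∩ {ω | c ≤ M (n + 1) ω}) := by
    intro n
    rw [Set.union_inter_distrib_left, Set.union_compl_self, Set.univ_inter]
    ext ω
    constructor
    · rintro ⟨t, ht, h⟩
      rcases eq_or_ne t (n + 1) with rfl | hne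
      · exact Or.inr h
      · exact Or.inl ⟨t, by simp only [Finset.mem_Icc] at ht ⊢; omega, h⟩
    · rintro (⟨t, ht, h⟩ | h)
      · exact ⟨t, by simp only [Finset.mem_Icc] at ht ⊢; omega, h⟩
      · exact ⟨n + 1, by simp, h⟩
  -- `B n` is the event of a crossing by time `n`. The invariant pairs the crossed mass, counted at
  -- level `c`, with the integral of `M` over the uncrossed part; Markov's inequality on the new
  -- crossings moves mass from the second term to the first.
  have hQ : ∀ n, n + 1 ≤ T → c * μ (B n) + ∫⁻ ω in (B n)ᶜ, M (n + 1) ω ∂μ ≤ 1 →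
      c * μ (B (n + 1)) + ∫⁻ ω in (B (n + 1))ᶜ, M (n + 1) ω ∂μ ≤ 1 := by
    intro n hn hP
    have hn' : n + 1 ∈ Finset.Icc 1 T := Finset.mem_Icc.2 ⟨by omega, hn⟩
    have hset : MeasurableSet {ω | c ≤ M (n + 1) ω} := hF _ hn' _ (hcm _ hn')
    have hsplit := lintegral_inter_add_sdiff (μ := μ) (M (n + 1)) (B n)ᶜ hset
    have hdiff : (B n)ᶜ \ {ω | c ≤ M (n + 1) ω} = (B (n + 1))ᶜ := by
      rw [hBsucc]; ext; simp; tauto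
    rw [hdiff] at hsplit
    have hmarkov : c * μ ((B n)ᶜ ∩ {ω | c ≤ M (n + 1) ω}) ≤
        ∫⁻ ω in (B n)ᶜ ∩ {ω | c ≤ M (n + 1) ω}, M (n + 1) ω ∂μ := by
      rw [← setLIntegral_const]
      exact setLIntegral_mono' ((hBm0 n (by omega)).compl.inter hset) fun ω hω => hω.2
    refine le_trans ?_ hP
    rw [← hsplit, ← add_assoc]
    gcongr
    calc c * μ (B (n + 1)) ≤ c * (μ (B n) + μ ((B n)ᶜ ∩ {ω | c ≤ M (n + 1) ω})) := by
          rw [hBsucc]; gcongr; exact measure_union_le _ _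
      _ ≤ _ := by rw [mul_add]; gcongr
  have hP : ∀ n, n + 1 ≤ T → c * μ (B n) + ∫⁻ ω in (B n)ᶜ, M (n + 1) ω ∂μ ≤ 1 := by
    intro n
    induction n with
    | zero => intro _; simpa [hB0] using h1
    | succ n ih =>
      intro hn
      refine le_trans ?_ (hQ n (by omega) (ih (by omega)))
      gcongr c * μ (B (n + 1)) + ?_
      exact hstep (n + 1) (Finset.mem_Ico.2 ⟨by omega, by omega⟩) _
        (hBm _ (Finset.mem_Icc.2 ⟨by omega, by omega⟩)).compl
  cases T with
  | zero => simp
  | succ n => exact le_self_add.trans (hQ n le_rfl (hP n le_rfl))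

end Subgaussian

end MeasureTheory

/-! ### The mixture supermartingale of the score -/

noncomputable section

namespace Matrix

variable {Ω n : Type*} [MeasurableSpace Ω] [Fintype n] {A : Ω → Matrix n n ℝ} {v w : Ω → n → ℝ}

lemma measurable_dotProduct_mulVec (hA : ∀ i j, Measurable fun ω => A ω i j)
    (hv : ∀ i, Measurable fun ω => v ω i) (hw : ∀ i, Measurable fun ω => w ω i) :
    Measurable fun ω => v ω ⬝ᵥ (A ω *ᵥ w ω) := by
  simp only [dotProduct, mulVec]
  fun_prop

variable [DecidableEq n]

lemma measurable_det (hA : ∀ i j, Measurable fun ω => A ω i j) :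
    Measurable fun ω => (A ω).det := by
  simp only [det_apply']
  fun_prop

/-- By Cramer's rule the entries are determinants divided by the determinant. -/
lemma measurable_inv_apply (hA : ∀ i j, Measurable fun ω => A ω i j) (i j : n) :
    Measurable fun ω => (A ω)⁻¹ i j := by
  simp only [inv_def, smul_apply, smul_eq_mul, adjugate_apply, Ring.inverse_eq_inv']
  refine (measurable_det hA).inv.mul (measurable_det fun k l => ?_)
  simp only [updateRow_apply]
  split_ifs
  · exact measurable_const
  · exact hA k l

end Matrix

namespace SafeBandit

variable {d : ℕ} {lam : ℝ}

/-- The noise term `∑_{k=1}^{t-1} ξ_k x_k` of the regularised least squares estimate. -/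
def score (x : ℕ → Vec d) (ξ : ℕ → ℝ) (t : ℕ) : Vec d :=
  ∑ k ∈ Finset.Ico 1 t, ξ k • x k

lemma score_succ (x : ℕ → Vec d) (ξ : ℕ → ℝ) {t : ℕ} (ht : 1 ≤ t) :
    score x ξ (t + 1) = score x ξ t + ξ t • x t :=
  Finset.sum_Ico_succ_top ht _

/-- The Gaussian mixture supermartingale `√(lam^d / det V_t) * exp (‖∑ ξ_k x_k‖²_{V_t⁻¹} / 2)`. -/
def mixture (lam : ℝ) (x : ℕ → Vec d) (ξ : ℕ → ℝ) (t : ℕ) : ℝ :=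
  √(lam ^ d / (design lam x t).det) *
    Real.exp ((score x ξ t).ofLp ⬝ᵥ ((design lam x t)⁻¹ *ᵥ (score x ξ t).ofLp) / 2)

lemma mixture_one (hlam : 0 < lam) (x : ℕ → Vec d) (ξ : ℕ → ℝ) : mixture lam x ξ 1 = 1 := by
  simp [mixture, score, design_one, hlam.ne']

lemma mixture_nonneg (x : ℕ → Vec d) (ξ : ℕ → ℝ) (t : ℕ) : 0 ≤ mixture lam x ξ t := by
  unfold mixture; positivity

/-- The rank-one updates of determinant and inverse form combine into a factor of exactly the shape
of `lintegral_exp_mul_sub_sq_gaussianReal`, with mean `xᵀ V⁻¹ S` and variance `xᵀ V⁻¹ x`. -/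
lemma mixture_succ (hlam : 0 < lam) (x : ℕ → Vec d) (ξ : ℕ → ℝ) {t : ℕ} (ht : 1 ≤ t) :
    mixture lam x ξ (t + 1) = mixture lam x ξ t *
      ((√(1 + (x t).ofLp ⬝ᵥ ((design lam x t)⁻¹ *ᵥ (x t).ofLp)))⁻¹ * Real.exp
        ((2 * ξ t * ((x t).ofLp ⬝ᵥ ((design lam x t)⁻¹ *ᵥ (score x ξ t).ofLp))
          + ξ t ^ 2 * ((x t).ofLp ⬝ᵥ ((design lam x t)⁻¹ *ᵥ (x t).ofLp))
          - ((x t).ofLp ⬝ᵥ ((design lam x t)⁻¹ *ᵥ (score x ξ t).ofLp)) ^ 2) /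
          (1 + (x t).ofLp ⬝ᵥ ((design lam x t)⁻¹ *ᵥ (x t).ofLp)) / 2)) := by
  have hV := design_posDef hlam x t
  rw [mixture, mixture, score_succ x ξ ht, design_succ lam x ht, WithLp.ofLp_add, WithLp.ofLp_smul,
    hV.inv_quadratic_update, hV.det_add_vecMulVec, ← div_div, Real.sqrt_div'
      (lam ^ d / (design lam x t).det), add_div, Real.exp_add]
  · ring
  · have := hV.inv.posSemidef.dotProduct_mulVec_self_nonneg (x t).ofLp
    positivity

section Measurability

variable {Ω : Type*} {x : ℕ → Ω → Vec d} {ξ : ℕ → Ω → ℝ}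

lemma history_mono (x : ℕ → Ω → Vec d) (ξ : ℕ → Ω → ℝ) : Monotone (history x ξ) := by
  intro s t hst
  refine sup_le_sup ?_ ?_
  · exact biSup_mono fun k hk => by simp only [Finset.mem_Icc] at hk ⊢; omega
  · exact biSup_mono fun k hk => by simp only [Finset.mem_Ico] at hk ⊢; omega

lemma history_le [m0 : MeasurableSpace Ω] {T : ℕ} (hx : ∀ t ∈ Finset.Icc 1 T, Measurable (x t))
    (hξ : ∀ t ∈ Finset.Icc 1 T, Measurable (ξ t)) {t : ℕ} (ht : t ≤ T) : history x ξ t ≤ m0 := by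
  refine sup_le (iSup₂_le fun k hk => ?_) (iSup₂_le fun k hk => ?_)
  · exact (hx k (by simp only [Finset.mem_Icc] at hk ⊢; omega)).comap_le
  · exact (hξ k (by simp only [Finset.mem_Icc, Finset.mem_Ico] at hk ⊢; omega)).comap_le

lemma measurable_history_action {k t : ℕ} (hk : k ∈ Finset.Icc 1 t) :
    Measurable[history x ξ t] (x k) := by
  refine Measurable.mono (comap_measurable (x k)) (le_trans ?_ le_sup_left) le_rfl
  exact le_iSup₂_of_le k hk le_rfl

lemma measurable_history_noise {k t : ℕ} (hk : k ∈ Finset.Ico 1 t) :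
    Measurable[history x ξ t] (ξ k) := by
  refine Measurable.mono (comap_measurable (ξ k)) (le_trans ?_ le_sup_right) le_rfl
  exact le_iSup₂_of_le k hk le_rfl

variable [MeasurableSpace Ω] {t : ℕ}

lemma measurable_design_apply (hx : ∀ k ∈ Finset.Ico 1 t, Measurable (x k)) (i j : Fin d) :
    Measurable fun ω => design lam (fun k => x k ω) t i j := by
  simp only [design, Matrix.add_apply, Matrix.sum_apply, Matrix.vecMulVec_apply]
  refine (Finset.measurable_fun_sum _ fun k hk => ?_).add_const _
  have := hx k hk
  fun_prop

lemma measurable_score_apply (hx : ∀ k ∈ Finset.Ico 1 t, Measurable (x k))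
    (hξ : ∀ k ∈ Finset.Ico 1 t, Measurable (ξ k)) (i : Fin d) :
    Measurable fun ω => score (fun k => x k ω) (fun k => ξ k ω) t i := by
  simp only [score, WithLp.ofLp_sum, WithLp.ofLp_smul, Finset.sum_apply, Pi.smul_apply]
  refine Finset.measurable_fun_sum _ fun k hk => ?_
  have := hx k hk
  have := hξ k hk
  fun_prop

lemma measurable_mixture (hx : ∀ k ∈ Finset.Ico 1 t, Measurable (x k))
    (hξ : ∀ k ∈ Finset.Ico 1 t, Measurable (ξ k)) :
    Measurable fun ω => mixture lam (fun k => x k ω) (fun k => ξ k ω) t := by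
  have h1 := Matrix.measurable_det (measurable_design_apply (lam := lam) hx)
  have h2 := Matrix.measurable_dotProduct_mulVec
    (Matrix.measurable_inv_apply (measurable_design_apply (lam := lam) hx))
    (measurable_score_apply hx hξ) (measurable_score_apply hx hξ)
  unfold mixture
  fun_prop

end Measurability

section Concentration

variable {Ω : Type*} [m0 : MeasurableSpace Ω] {μ : Measure Ω} [IsProbabilityMeasure μ] {ρ : ℝ} {T : ℕ}
  {x : ℕ → Ω → Vec d} {ξ : ℕ → Ω → ℝ}

/-- This is the subgaussian bound at `s = c / ρ`, multiplied by `exp (-c² / 2)`: dividing by `ρ`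
makes the noise 1-subgaussian. -/
lemma CondSubgaussian.setLIntegral_exp_le (hξ : CondSubgaussian μ ρ T x ξ) (hρ : 0 < ρ)
    (hx : ∀ t ∈ Finset.Icc 1 T, Measurable (x t)) {t : ℕ} (ht : t ∈ Finset.Icc 1 T) (c : ℝ)
    {A : Set Ω} (hA : MeasurableSet[history x ξ t] A) :
    ∫⁻ ω in A, ENNReal.ofReal (Real.exp (c * (ξ t ω / ρ) - c ^ 2 / 2)) ∂μ ≤ μ A := by
  have hm := history_le hx hξ.measurable (Finset.mem_Icc.1 ht).2
  have h := setLIntegral_ofReal_le_of_condExp_le hm (hξ.integrable_exp t ht (c / ρ))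
    (fun ω => (Real.exp_pos _).le) (Real.exp_pos _).le (hξ.condExp_exp_le t ht (c / ρ)) hA
  have hmeas := hξ.measurable t ht
  have hexp : ∀ ω, ENNReal.ofReal (Real.exp (c * (ξ t ω / ρ) - c ^ 2 / 2)) =
      ENNReal.ofReal (Real.exp (-(c ^ 2 / 2))) * ENNReal.ofReal (Real.exp (c / ρ * ξ t ω)) := by
    intro ω
    rw [← ENNReal.ofReal_mul (Real.exp_pos _).le, ← Real.exp_add]
    congr 2
    ring
  simp_rw [hexp]
  rw [lintegral_const_mul _ (by fun_prop)]
  calc ENNReal.ofReal (Real.exp (-(c ^ 2 / 2))) *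
        ∫⁻ ω in A, ENNReal.ofReal (Real.exp (c / ρ * ξ t ω)) ∂μ
      ≤ ENNReal.ofReal (Real.exp (-(c ^ 2 / 2))) *
        (ENNReal.ofReal (Real.exp ((c / ρ) ^ 2 * ρ ^ 2 / 2)) * μ A) := by gcongr
    _ = μ A := by
        rw [← mul_assoc, ← ENNReal.ofReal_mul (Real.exp_pos _).le, ← Real.exp_add, div_pow,
          div_mul_cancel₀ _ (by positivity), neg_add_cancel, Real.exp_zero, ENNReal.ofReal_one,
          one_mul]

/-- The mean and variance of the Gaussian average depend on `x_t` and the past but not on `ξ_t`,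
hence are measurable with respect to the history, so the mixture bound applies with the current
mixture cut off to `A` as weight. -/
lemma CondSubgaussian.setLIntegral_mixture_succ_le (hξ : CondSubgaussian μ ρ T x ξ) (hρ : 0 < ρ)
    (hlam : 0 < lam) (hx : ∀ t ∈ Finset.Icc 1 T, Measurable (x t)) {t : ℕ}
    (ht : t ∈ Finset.Icc 1 T) {A : Set Ω} (hA : MeasurableSet[history x ξ t] A) :
    ∫⁻ ω in A, ENNReal.ofReal (mixture lam (fun k => x k ω) (fun k => ξ k ω / ρ) (t + 1)) ∂μ ≤
      ∫⁻ ω in A, ENNReal.ofReal (mixture lam (fun k => x k ω) (fun k => ξ k ω / ρ) t) ∂μ := by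
  have ht1 := (Finset.mem_Icc.1 ht).1
  have hm := history_le hx hξ.measurable (Finset.mem_Icc.1 ht).2
  have hxh : ∀ k ∈ Finset.Ico 1 t, Measurable[history x ξ t] (x k) := fun k hk =>
    measurable_history_action (Finset.Ico_subset_Icc_self hk)
  have hξh : ∀ k ∈ Finset.Ico 1 t, Measurable[history x ξ t] fun ω => ξ k ω / ρ := fun k hk =>
    (measurable_history_noise hk).div_const ρ
  have hxt : Measurable[history x ξ t] (x t) := measurable_history_action (by simp [ht1])
  have hxt' : ∀ i, Measurable[history x ξ t] fun ω => x t ω i := fun i => by fun_prop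
  have hinv := @Matrix.measurable_inv_apply Ω _ (history x ξ t) _ _ _
    (@measurable_design_apply d lam Ω x (history x ξ t) t hxh)
  have hs := @Matrix.measurable_dotProduct_mulVec Ω _ (history x ξ t) _ _ _ _ hinv hxt'
    (@measurable_score_apply d Ω x (fun k ω => ξ k ω / ρ) (history x ξ t) t hxh hξh)
  have hu := @Matrix.measurable_dotProduct_mulVec Ω _ (history x ξ t) _ _ _ _ hinv hxt' hxt'
  have hY : Measurable[history x ξ t] (A.indicator fun ω => ENNReal.ofReal
      (mixture lam (fun k => x k ω) (fun k => ξ k ω / ρ) t)) :=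
    (@measurable_mixture d lam Ω x (fun k ω => ξ k ω / ρ) (history x ξ t) t hxh
      hξh).ennreal_ofReal.indicator hA
  have h := lintegral_mul_gaussian_mixture_le (μ := μ) hm ((hξ.measurable t ht).div_const ρ) hs hu
    (fun ω => (design_posDef hlam _ t).inv.posSemidef.dotProduct_mulVec_self_nonneg _) hY
    (fun c A hA => hξ.setLIntegral_exp_le hρ hx ht c hA)
  rw [lintegral_indicator (hm _ hA)] at h
  refine le_trans (le_of_eq ?_) h
  rw [← lintegral_indicator (hm _ hA)]
  refine lintegral_congr fun ω => ?_
  by_cases hω : ω ∈ A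
  · simp only [Set.indicator_of_mem hω]
    rw [mixture_succ hlam _ _ ht1, ENNReal.ofReal_mul (mixture_nonneg _ _ _)]
  · simp [Set.indicator_of_notMem hω]

/-- The self-normalised maximal inequality. -/
lemma CondSubgaussian.measure_exists_mixture_ge_le (hξ : CondSubgaussian μ ρ T x ξ) (hρ : 0 < ρ)
    (hlam : 0 < lam) (hx : ∀ t ∈ Finset.Icc 1 T, Measurable (x t)) {c : ℝ} (hc : 0 < c) :
    μ {ω | ∃ t ∈ Finset.Icc 1 T, c ≤ mixture lam (fun k => x k ω) (fun k => ξ k ω / ρ) t} ≤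
      ENNReal.ofReal c⁻¹ := by
  have h := measure_exists_ge_le_of_setLIntegral_succ_le (μ := μ) (F := history x ξ) (T := T)
    (M := fun t ω => ENNReal.ofReal (mixture lam (fun k => x k ω) (fun k => ξ k ω / ρ) t))
    (fun t ht => history_le hx hξ.measurable (Finset.mem_Icc.1 ht).2) (history_mono x ξ)
    (fun t ht => (@measurable_mixture d lam Ω x (fun k ω => ξ k ω / ρ) (history x ξ t) t
      (fun k hk => measurable_history_action (Finset.Ico_subset_Icc_self hk))
      (fun k hk => (measurable_history_noise hk).div_const ρ)).ennreal_ofReal)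
    (by simp [mixture_one hlam])
    (fun t ht A hA => hξ.setLIntegral_mixture_succ_le hρ hlam hx
      (Finset.Ico_subset_Icc_self ht) hA) (ENNReal.ofReal c)
  simp only [ENNReal.ofReal_le_ofReal_iff (mixture_nonneg _ _ _)] at h
  rw [ENNReal.ofReal_inv_of_pos hc, ← one_div, ENNReal.le_div_iff_mul_le (by simp [hc]) (by simp),
    mul_comm]
  exact h

/-- Here the moment bounds at `s = ±1` give `E[exp ξ + exp (-ξ)] ≤ 2`, while the integrand is at
least 2 and equals 2 only at `ξ = 0`. This covers `ρ = 0`, where normalising by `ρ` is impossible.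
-/
lemma CondSubgaussian.ae_eq_zero (hξ : CondSubgaussian μ 0 T x ξ)
    (hx : ∀ t ∈ Finset.Icc 1 T, Measurable (x t)) {t : ℕ} (ht : t ∈ Finset.Icc 1 T) :
    ∀ᵐ ω ∂μ, ξ t ω = 0 := by
  have hm := history_le hx hξ.measurable (Finset.mem_Icc.1 ht).2
  have hint := hξ.integrable_exp t ht
  have hle : ∀ s : ℝ, ∫ ω, Real.exp (s * ξ t ω) ∂μ ≤ 1 := by
    intro s
    rw [← integral_condExp hm]
    refine (integral_mono_ae integrable_condExp (integrable_const 1) ?_).trans (by simp)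
    simpa using hξ.condExp_exp_le t ht s
  have hnonneg : ∀ ω, 0 ≤ Real.exp (1 * ξ t ω) + Real.exp (-1 * ξ t ω) - 2 := by
    intro ω
    have h1 := Real.add_one_le_exp (1 * ξ t ω)
    have h2 := Real.add_one_le_exp (-1 * ξ t ω)
    linarith
  have hadd : Integrable (fun ω => Real.exp (1 * ξ t ω) + Real.exp (-1 * ξ t ω)) μ :=
    (hint 1).add (hint (-1))
  have hint2 : Integrable (fun ω => Real.exp (1 * ξ t ω) + Real.exp (-1 * ξ t ω) - 2) μ :=
    hadd.sub (integrable_const 2)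
  have hzero : ∫ ω, (Real.exp (1 * ξ t ω) + Real.exp (-1 * ξ t ω) - 2) ∂μ = 0 := by
    refine le_antisymm ?_ (integral_nonneg hnonneg)
    rw [integral_sub hadd (integrable_const 2),
      integral_add (hint 1) (hint (-1))]
    have h1 := hle 1
    have h2 := hle (-1)
    simp only [integral_const, probReal_univ, smul_eq_mul, one_mul] at *
    linarith
  filter_upwards [(integral_eq_zero_iff_of_nonneg hnonneg hint2).1 hzero] with ω hω
  by_contra hne
  have h1 := Real.add_one_lt_exp (x := 1 * ξ t ω) (by simpa using hne)
  have h2 := Real.add_one_le_exp (-1 * ξ t ω)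
  simp only [Pi.zero_apply] at hω
  linarith

end Concentration

end SafeBandit

end

/-! ### Confidence bounds for the ridge estimates -/

noncomputable section

namespace SafeBandit

variable {d : ℕ} {lam : ℝ}

section Confidence

/-- The score is at most the first term of the confidence radius when the mixture is small. -/
lemma weightedNorm_score_le_of_mixture_lt (hd : 2 ≤ d) (hlam : 0 < lam) {ρ δ : ℝ} (hρ : 0 < ρ)
    (hδ : δ ∈ Set.Ioo (0 : ℝ) 1) {x : ℕ → Vec d} {ξ : ℕ → ℝ} {t : ℕ} (ht : 1 ≤ t)
    (hx : ∀ k ∈ Finset.Ico 1 t, ‖x k‖ ≤ 1)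
    (h : mixture lam x (fun k => ξ k / ρ) t < (δ / 2)⁻¹) :
    weightedNorm (design lam x t)⁻¹ (score x ξ t) ≤
      ρ * √(d * Real.log ((1 + ((t : ℝ) - 1) / lam) / (δ / 2))) := by
  have hV := design_posDef hlam x t
  have hdet := hV.det_pos
  have hδ0 : 0 < δ / 2 := by linarith [hδ.1]
  have hd' : (2 : ℝ) ≤ d := by exact_mod_cast hd
  have ht' : (0 : ℝ) ≤ (t : ℝ) - 1 := by
    have : (1 : ℝ) ≤ t := by exact_mod_cast ht
    linarith
  have hscore : score x ξ t = ρ • score x (fun k => ξ k / ρ) t := by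
    rw [score, score, Finset.smul_sum]
    refine Finset.sum_congr rfl fun k _ => ?_
    rw [smul_smul, mul_div_cancel₀ _ hρ.ne']
  rw [hscore, weightedNorm_smul _ hρ.le]
  refine mul_le_mul_of_nonneg_left (Real.sqrt_le_sqrt ?_) hρ.le
  set q := (score x (fun k => ξ k / ρ) t).ofLp ⬝ᵥ
    ((design lam x t)⁻¹ *ᵥ (score x (fun k => ξ k / ρ) t).ofLp) with hq
  have hlog := Real.log_lt_log (mul_pos (Real.sqrt_pos.2 (by positivity)) (Real.exp_pos _)) h
  rw [Real.log_mul (Real.sqrt_pos.2 (by positivity)).ne' (Real.exp_pos _).ne', Real.log_exp,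
    Real.log_sqrt (by positivity), ← hq, Real.log_inv] at hlog
  have hinv : Real.log (lam ^ d / (design lam x t).det) =
      -Real.log ((design lam x t).det / lam ^ d) := by
    rw [← Real.log_inv, inv_div]
  rw [hinv] at hlog
  have hdl := log_det_design_le (by omega) hlam ht hx
  have hlogδ : Real.log (δ / 2) ≤ 0 := Real.log_nonpos hδ0.le (by linarith [hδ.2])
  have hmono : Real.log (1 + ((t : ℝ) - 1) / (lam * d)) ≤ Real.log (1 + ((t : ℝ) - 1) / lam) := by
    apply Real.log_le_log (by positivity)
    gcongr
    nlinarith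
  rw [Real.log_div (by positivity) hδ0.ne']
  -- The logarithm of the mixture bound contributes `2 log (2 / δ)`, which `d ≥ 2` absorbs into `d
  -- log (2 / δ)`.
  nlinarith

lemma CondSubgaussian.exists_weightedNorm_score_le {Ω : Type*} [MeasurableSpace Ω] {μ : Measure Ω}
    [IsProbabilityMeasure μ] (hd : 2 ≤ d) (hlam : 0 < lam) {ρ δ : ℝ} (hρ : 0 ≤ ρ)
    (hδ : δ ∈ Set.Ioo (0 : ℝ) 1) {T : ℕ} {x : ℕ → Ω → Vec d} {ξ : ℕ → Ω → ℝ}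
    (hξ : CondSubgaussian μ ρ T x ξ) (hx : ∀ t ∈ Finset.Icc 1 T, Measurable (x t))
    (hx1 : ∀ t ∈ Finset.Icc 1 T, ∀ ω, ‖x t ω‖ ≤ 1) :
    ∃ N : Set Ω, μ N ≤ ENNReal.ofReal (δ / 2) ∧ ∀ ω ∉ N, ∀ t ∈ Finset.Icc 1 T,
      weightedNorm (design lam (fun k => x k ω) t)⁻¹ (score (fun k => x k ω) (fun k => ξ k ω) t) ≤
        ρ * √(d * Real.log ((1 + ((t : ℝ) - 1) / lam) / (δ / 2))) := by
  rcases hρ.eq_or_lt with rfl | hρ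
  · refine ⟨{ω | ¬ ∀ t ∈ Finset.Icc 1 T, ξ t ω = 0}, ?_, fun ω hω t ht => ?_⟩
    · have h : ∀ᵐ ω ∂μ, ∀ t ∈ Finset.Icc 1 T, ξ t ω = 0 :=
        (Filter.eventually_all_finset _).2 fun t ht => hξ.ae_eq_zero hx ht
      rw [ae_iff.1 h]
      exact zero_le
    · have hω' : ∀ t ∈ Finset.Icc 1 T, ξ t ω = 0 := by simpa using hω
      have hs : score (fun k => x k ω) (fun k => ξ k ω) t = 0 := by
        refine Finset.sum_eq_zero fun k hk => ?_
        simp only [hω' k (by simp only [Finset.mem_Icc, Finset.mem_Ico] at hk ht ⊢; omega), zero_smul]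
      simp [hs, weightedNorm]
  · have hδ0 : 0 < δ / 2 := by linarith [hδ.1]
    refine ⟨_, (hξ.measure_exists_mixture_ge_le hρ hlam hx (inv_pos.2 hδ0)).trans
      (by rw [inv_inv]), fun ω hω t ht => ?_⟩
    simp only [Set.mem_ofPred_eq, not_exists, not_and, not_le] at hω
    exact weightedNorm_score_le_of_mixture_lt hd hlam hρ hδ (Finset.mem_Icc.1 ht).1
      (fun k hk => hx1 k (by simp only [Finset.mem_Icc, Finset.mem_Ico] at hk ht ⊢; omega) ω)
      (hω t ht)

lemma design_mulVec (lam : ℝ) (x : ℕ → Vec d) (t : ℕ) (θ : Vec d) :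
    design lam x t *ᵥ θ.ofLp =
      ∑ k ∈ Finset.Ico 1 t, inner ℝ θ (x k) • (x k).ofLp + lam • θ.ofLp := by
  rw [design, Matrix.add_mulVec, Matrix.sum_mulVec, Matrix.smul_mulVec, Matrix.one_mulVec]
  congr 1
  refine Finset.sum_congr rfl fun k _ => ?_
  rw [Matrix.vecMulVec_mulVec, real_inner_comm, inner_eq_dotProduct]
  ext i
  simp [mul_comm]

/-- The ridge estimate is accurate when the score is small. -/
lemma abs_inner_ridge_sub_inner_le (hlam : 0 < lam) (x : ℕ → Vec d) (ξ : ℕ → ℝ) (t : ℕ)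
    {θ : Vec d} {S r : ℝ} (hθ : ‖θ‖ ≤ S)
    (hr : weightedNorm (design lam x t)⁻¹ (score x ξ t) ≤ r) (u : Vec d) :
    |inner ℝ (ridge lam x (fun k => inner ℝ θ (x k) + ξ k) t) u - inner ℝ θ u| ≤
      (r + √lam * S) * weightedNorm (design lam x t)⁻¹ u := by
  have hV := design_posDef hlam x t
  have hW := hV.inv.posSemidef
  have hsum : ∑ k ∈ Finset.Ico 1 t, (inner ℝ θ (x k) + ξ k) • (x k).ofLp =
      design lam x t *ᵥ θ.ofLp + ((score x ξ t).ofLp - lam • θ.ofLp) := by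
    rw [design_mulVec, score, WithLp.ofLp_sum]
    simp only [add_smul, Finset.sum_add_distrib, WithLp.ofLp_smul]
    abel
  have hridge : (ridge lam x (fun k => inner ℝ θ (x k) + ξ k) t).ofLp =
      θ.ofLp + ((design lam x t)⁻¹ *ᵥ (score x ξ t).ofLp
        - lam • ((design lam x t)⁻¹ *ᵥ θ.ofLp)) := by
    rw [ridge, hsum, Matrix.mulVec_add, hV.inv_mulVec_eq rfl, Matrix.mulVec_sub,
      Matrix.mulVec_smul]
  have hdiff : inner ℝ (ridge lam x (fun k => inner ℝ θ (x k) + ξ k) t) u - inner ℝ θ u =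
      u.ofLp ⬝ᵥ ((design lam x t)⁻¹ *ᵥ (score x ξ t).ofLp)
        - lam * (u.ofLp ⬝ᵥ ((design lam x t)⁻¹ *ᵥ θ.ofLp)) := by
    rw [inner_eq_dotProduct, inner_eq_dotProduct, hridge, add_dotProduct, add_sub_cancel_left,
      dotProduct_comm, dotProduct_sub, dotProduct_smul, smul_eq_mul]
  -- The regularisation bias is `lam V⁻¹ θ`; since `V ≥ lam I`, its effect is only of order `√lam`.
  have hθn : lam * weightedNorm (design lam x t)⁻¹ θ ≤ √lam * S := by
    have h1 : weightedNorm (design lam x t)⁻¹ θ ≤ ‖θ‖ / √lam := by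
      refine abs_le_of_sq_le_sq' ?_ (by positivity) |>.2
      rw [div_pow, Real.sq_sqrt hlam.le]
      exact sq_weightedNorm_design_inv_le hlam x t θ
    calc lam * weightedNorm (design lam x t)⁻¹ θ ≤ lam * (‖θ‖ / √lam) := by gcongr
      _ = √lam * ‖θ‖ := by
          rw [mul_div_left_comm, Real.div_sqrt, mul_comm]
      _ ≤ √lam * S := by gcongr
  have hu := weightedNorm_nonneg (design lam x t)⁻¹ u
  have h1 := abs_dotProduct_mulVec_le hW u (score x ξ t)
  have h2 := abs_dotProduct_mulVec_le hW u θ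
  rw [hdiff]
  calc _ ≤ |u.ofLp ⬝ᵥ ((design lam x t)⁻¹ *ᵥ (score x ξ t).ofLp)|
        + |lam * (u.ofLp ⬝ᵥ ((design lam x t)⁻¹ *ᵥ θ.ofLp))| := abs_sub _ _
    _ = |u.ofLp ⬝ᵥ ((design lam x t)⁻¹ *ᵥ (score x ξ t).ofLp)|
        + lam * |u.ofLp ⬝ᵥ ((design lam x t)⁻¹ *ᵥ θ.ofLp)| := by
        rw [abs_mul, abs_of_pos hlam]
    _ ≤ weightedNorm (design lam x t)⁻¹ u * weightedNorm (design lam x t)⁻¹ (score x ξ t)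
        + lam * (weightedNorm (design lam x t)⁻¹ u * weightedNorm (design lam x t)⁻¹ θ) := by
        gcongr
    _ ≤ weightedNorm (design lam x t)⁻¹ u * r
        + weightedNorm (design lam x t)⁻¹ u * (√lam * S) := by
        rw [mul_left_comm]
        gcongr
    _ = _ := by ring

end Confidence

/-! ### Safety and regret of a single round -/

section Round

variable {X : Set (Vec d)} {b ν β : ℝ} {thetahat ahat : Vec d} {V : Matrix (Fin d) (Fin d) ℝ}
  {x : Vec d}

lemma normScale_mem_Icc (hν : 0 ≤ ν) (x : Vec d) : normScale ν x ∈ Set.Icc (0 : ℝ) 1 := by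
  unfold normScale
  split_ifs
  · simp
  · exact ⟨le_min (by positivity) zero_le_one, min_le_right _ _⟩

lemma norm_normScale_smul_le (hν : 0 ≤ ν) (x : Vec d) : ‖normScale ν x • x‖ ≤ ν := by
  rw [norm_smul, Real.norm_of_nonneg (normScale_mem_Icc hν x).1]
  unfold normScale
  split_ifs with h
  · simpa [h] using hν
  · calc min (ν / ‖x‖) 1 * ‖x‖ ≤ ν / ‖x‖ * ‖x‖ := by gcongr; exact min_le_left _ _
      _ = ν := div_mul_cancel₀ _ h

lemma smul_mem_of_starConvex (hX : StarConvex ℝ 0 X) {c : ℝ} (hc : c ∈ Set.Icc (0 : ℝ) 1)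
    (hx : x ∈ X) : c • x ∈ X :=
  hX.smul_mem hx hc.1 hc.2

lemma IsROFULAction.mem (hX : StarConvex ℝ 0 X) (hν : 0 ≤ ν)
    (h : IsROFULAction X b ν thetahat ahat β V x) : x ∈ X := by
  obtain ⟨xt, m, hxt, hm, rfl⟩ := h
  have h1 := normScale_mem_Icc hν xt
  exact smul_mem_of_starConvex hX ⟨le_max_of_le_left h1.1, max_le h1.2 hm.1.1.2⟩ hxt.1.1

/-- A ROFUL action is safe when the confidence set of the constraint holds. -/
lemma IsROFULAction.mem_feasible (hX : StarConvex ℝ 0 X) {a : Vec d} {Sa : ℝ} (hb : 0 ≤ b)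
    (hSa : 0 < Sa) (ha : ‖a‖ ≤ Sa)
    (hconf : ∀ u, |inner ℝ ahat u - inner ℝ a u| ≤ β * weightedNorm V⁻¹ u)
    (h : IsROFULAction X b (b / Sa) thetahat ahat β V x) : x ∈ feasible X a b := by
  have hν : 0 ≤ b / Sa := by positivity
  refine ⟨h.mem hX hν, ?_⟩
  obtain ⟨xt, m, hxt, hm, rfl⟩ := h
  rcases max_choice (normScale (b / Sa) xt) m with hmax | hmax
  · rw [hmax]
    calc inner ℝ a (normScale (b / Sa) xt • xt) ≤ ‖a‖ * ‖normScale (b / Sa) xt • xt‖ :=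
          real_inner_le_norm _ _
      _ ≤ Sa * (b / Sa) := by gcongr; exact norm_normScale_smul_le hν xt
      _ = b := mul_div_cancel₀ _ hSa.ne'
  · rw [hmax]
    have h1 := (abs_le.1 (hconf (m • xt))).1
    have h2 : inner ℝ ahat (m • xt) + β * weightedNorm V⁻¹ (m • xt) ≤ b := hm.1.2.2
    linarith

/-- The regret of one round when both confidence sets hold. -/
lemma IsROFULAction.regret_le (hX : StarConvex ℝ 0 X) (hXn : ∀ x ∈ X, ‖x‖ ≤ 1) (hb : 0 < b)
    (hν : 0 ≤ ν) (hβ : 0 ≤ β) {a θ xstar : Vec d} {Sa Sθ : ℝ} (hbS : b ≤ Sa) (hSθ : ‖θ‖ ≤ Sθ)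
    (hxstar : xstar ∈ feasible X a b)
    (hconfθ : ∀ u, |inner ℝ thetahat u - inner ℝ θ u| ≤ β * weightedNorm V⁻¹ u)
    (hconfa : ∀ u, |inner ℝ ahat u - inner ℝ a u| ≤ β * weightedNorm V⁻¹ u)
    (h : IsROFULAction X b ν thetahat ahat β V x) :
    inner ℝ θ (xstar - x) ≤ 2 * ((Sθ + Sa) / b) * β * weightedNorm V⁻¹ x := by
  obtain ⟨xt, m, ⟨hxt, hmax⟩, ⟨hm, hgreatest⟩, rfl⟩ := h
  have hs := normScale_mem_Icc hν xt
  set γ := max (normScale ν xt) m with hγ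
  have hγ0 : 0 ≤ γ := le_max_of_le_left hs.1
  have hγ1 : γ ≤ 1 := max_le hs.2 hm.1.2
  have hmγ : m ≤ γ := le_max_right _ _
  rw [inner_sub_right, inner_smul_right, weightedNorm_smul _ hγ0]
  have hw := weightedNorm_nonneg V⁻¹ xt
  set w := weightedNorm V⁻¹ xt with hwdef
  have hoptset : xstar ∈ optimistic X b ahat β V := by
    refine ⟨hxstar.1, ?_⟩
    have h1 := (abs_le.1 (hconfa xstar)).2
    have h2 := hxstar.2
    linarith
  have hopt : inner ℝ θ xstar ≤ inner ℝ θ xt + 2 * β * w := by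
    have h1 := hmax xstar hoptset
    have h2 := (abs_le.1 (hconfθ xstar)).1
    have h3 := (abs_le.1 (hconfθ xt)).2
    simp only at h1
    linarith
  have hD : 0 < b + 2 * β * w := by positivity
  -- Optimism gives `âᵀ xt + β w ≤ b + 2 β w`, so scaling by this ratio brings the pessimistic
  -- constraint value down to `b`.
  have hmge : b / (b + 2 * β * w) ≤ m := by
    have hc0 : 0 ≤ b / (b + 2 * β * w) := by positivity
    have hc1 : b / (b + 2 * β * w) ≤ 1 := by
      rw [div_le_one hD]
      have : 0 ≤ 2 * β * w := by positivity
      linarith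
    refine hgreatest ⟨⟨hc0, hc1⟩, smul_mem_of_starConvex hX ⟨hc0, hc1⟩ hxt.1, ?_⟩
    rw [inner_smul_right, weightedNorm_smul _ hc0]
    have h1 : inner ℝ ahat xt - β * w ≤ b := hxt.2
    calc b / (b + 2 * β * w) * inner ℝ ahat xt + β * (b / (b + 2 * β * w) * w)
        = b / (b + 2 * β * w) * (inner ℝ ahat xt + β * w) := by ring
      _ ≤ b / (b + 2 * β * w) * (b + 2 * β * w) :=
          mul_le_mul_of_nonneg_left (by linarith) hc0
      _ = b := div_mul_cancel₀ _ hD.ne'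
  have hγge : b ≤ γ * (b + 2 * β * w) := (div_le_iff₀ hD).1 (hmge.trans hmγ)
  -- The gap is bounded by `γ * w`, the norm of the played action, rather than by `w`; only played
  -- actions enter the elliptical potential.
  have hγgap : 1 - γ ≤ 2 * β * (γ * w) / b := by
    rw [le_div_iff₀ hb]
    linarith
  have hθx : inner ℝ θ xstar ≤ Sθ := by
    calc inner ℝ θ xstar ≤ ‖θ‖ * ‖xstar‖ := real_inner_le_norm _ _
      _ ≤ ‖θ‖ * 1 := by gcongr; exact hXn _ hxstar.1
      _ ≤ Sθ := by linarith
  have hSθ0 : 0 ≤ Sθ := (norm_nonneg _).trans hSθ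
  -- Used to enlarge the estimation loss by `Sa / b`, so that it shares the factor `1 / b` with the
  -- scaling loss.
  have hone : 1 ≤ Sa / b := (one_le_div hb).2 hbS
  have hz : 0 ≤ 2 * β * (γ * w) := by positivity
  calc inner ℝ θ xstar - γ * inner ℝ θ xt
      = (1 - γ) * inner ℝ θ xstar + γ * (inner ℝ θ xstar - inner ℝ θ xt) := by ring
    _ ≤ (1 - γ) * Sθ + γ * (2 * β * w) := by
        gcongr
        linarith
    _ ≤ 2 * β * (γ * w) / b * Sθ + 2 * β * (γ * w) * (Sa / b) := by
        have h1 := mul_le_mul_of_nonneg_right hγgap hSθ0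
        have h2 := mul_le_mul_of_nonneg_left hone hz
        linarith
    _ = 2 * ((Sθ + Sa) / b) * β * (γ * w) := by ring

end Round

/-! ### Summation over rounds and the growth rate -/

section Regret

lemma one_le_confidence_ratio (hlam : 0 < lam) {δ : ℝ} (hδ : δ ∈ Set.Ioo (0 : ℝ) 1) {t : ℕ}
    (ht : 1 ≤ t) : 1 ≤ (1 + ((t : ℝ) - 1) / lam) / (δ / 2) := by
  have ht' : (0 : ℝ) ≤ (t : ℝ) - 1 := by
    have : (1 : ℝ) ≤ t := by exact_mod_cast ht
    linarith
  have h1 : 0 ≤ ((t : ℝ) - 1) / lam := by positivity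
  rw [one_le_div (by linarith [hδ.1])]
  linarith [hδ.2]

lemma beta_nonneg (d : ℕ) {ρ S : ℝ} (δ lam : ℝ) (hρ : 0 ≤ ρ) (hS : 0 ≤ S) (t : ℕ) :
    0 ≤ beta d ρ δ lam S t := by
  unfold beta; positivity

lemma beta_mono (d : ℕ) {ρ δ : ℝ} (S : ℝ) (hρ : 0 ≤ ρ) (hδ : δ ∈ Set.Ioo (0 : ℝ) 1)
    (hlam : 0 < lam) {s t : ℕ} (hs : 1 ≤ s) (hst : s ≤ t) :
    beta d ρ δ lam S s ≤ beta d ρ δ lam S t := by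
  have h := one_le_confidence_ratio hlam hδ hs
  have hδ0 := hδ.1
  unfold beta
  gcongr

/-- The regret bound from the one-round bounds. -/
lemma regret_le_regretBound (hd : 0 < d) (hlam : 1 ≤ lam) {b Sa Sθ ρ δ : ℝ} {T : ℕ} (hb : 0 < b)
    (hSa : 0 ≤ Sa) (hSθ : 0 ≤ Sθ) (hρ : 0 ≤ ρ) (hδ : δ ∈ Set.Ioo (0 : ℝ) 1) {x : ℕ → Vec d}
    {θ xstar : Vec d} (hx : ∀ t ∈ Finset.Icc 1 T, ‖x t‖ ≤ 1)
    (h : ∀ t ∈ Finset.Icc 1 T, inner ℝ θ (xstar - x t) ≤ 2 * ((Sθ + Sa) / b) *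
      beta d ρ δ lam (max Sa Sθ) t * weightedNorm (design lam x t)⁻¹ (x t)) :
    regret θ xstar x T ≤ regretBound d b Sa Sθ ρ δ lam T := by
  have hβ := beta_nonneg d δ lam hρ (le_max_of_le_left hSa : 0 ≤ max Sa Sθ) T
  have hsq := sum_sq_weightedNorm_le hd hlam hx
  have hcs : ∑ t ∈ Finset.Icc 1 T, weightedNorm (design lam x t)⁻¹ (x t) ≤
      √(2 * d * T * Real.log (1 + T / (lam * d))) := by
    apply Real.le_sqrt_of_sq_le
    refine sq_sum_le_card_mul_sum_sq.trans ?_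
    rw [Nat.card_Icc, Nat.add_sub_cancel]
    calc _ ≤ (T : ℝ) * (2 * d * Real.log (1 + T / (lam * d))) := by gcongr
      _ = _ := by ring
  rw [regret, regretBound]
  calc ∑ t ∈ Finset.Icc 1 T, inner ℝ θ (xstar - x t)
      ≤ ∑ t ∈ Finset.Icc 1 T, 2 * ((Sθ + Sa) / b) * beta d ρ δ lam (max Sa Sθ) T *
          weightedNorm (design lam x t)⁻¹ (x t) := by
        refine Finset.sum_le_sum fun t ht => (h t ht).trans ?_
        obtain ⟨ht1, htT⟩ := Finset.mem_Icc.1 ht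
        have := beta_mono d (max Sa Sθ) hρ hδ (by linarith : 0 < lam) ht1 htT
        have := weightedNorm_nonneg (design lam x t)⁻¹ (x t)
        gcongr
    _ = 2 * ((Sθ + Sa) / b) * beta d ρ δ lam (max Sa Sθ) T *
          ∑ t ∈ Finset.Icc 1 T, weightedNorm (design lam x t)⁻¹ (x t) := by rw [Finset.mul_sum]
    _ ≤ _ := by gcongr

lemma log_one_add_le_two_mul_log {T : ℕ} (hT : 2 ≤ T) : Real.log (1 + T) ≤ 2 * Real.log T := by
  have hT' : (2 : ℝ) ≤ T := by exact_mod_cast hT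
  rw [← Real.log_rpow (by linarith)]
  apply Real.log_le_log (by positivity)
  norm_num
  nlinarith

/-- The confidence radius is `O(√(d log T))`. -/
lemma exists_beta_le {ρ δ S : ℝ} (hρ : 0 ≤ ρ) (hδ : δ ∈ Set.Ioo (0 : ℝ) 1) (hlam : 1 ≤ lam)
    (hS : 0 ≤ S) : ∃ C : ℝ, 0 ≤ C ∧ ∀ d T : ℕ, 1 ≤ d → 2 ≤ T →
      beta d ρ δ lam S T ≤ C * √(d * Real.log T) := by
  have hlog2 : 0 < Real.log 2 := Real.log_pos (by norm_num)
  have hδ0 : 0 < δ / 2 := by linarith [hδ.1]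
  have hδlog : 0 ≤ -Real.log (δ / 2) := by
    linarith [Real.log_nonpos hδ0.le (by linarith [hδ.2])]
  -- The 2 comes from `1 + T ≤ T²`; the constant `log (2 / δ)` is absorbed using `log T ≥ log 2`.
  set K := 2 + -Real.log (δ / 2) / Real.log 2
  have hK : 0 ≤ K := by positivity
  refine ⟨ρ * √K + √lam * S / √(Real.log 2), by positivity, fun d T hd hT => ?_⟩
  have hT' : (2 : ℝ) ≤ T := by exact_mod_cast hT
  have hd' : (1 : ℝ) ≤ d := by exact_mod_cast hd
  have hlogT : Real.log 2 ≤ Real.log T := Real.log_le_log (by norm_num) hT'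
  have hratio : Real.log ((1 + ((T : ℝ) - 1) / lam) / (δ / 2)) ≤ K * Real.log T := by
    have hpos : 0 ≤ ((T : ℝ) - 1) / lam := div_nonneg (by linarith) (by linarith)
    rw [Real.log_div (by positivity) hδ0.ne']
    have h1 : Real.log (1 + ((T : ℝ) - 1) / lam) ≤ 2 * Real.log T := by
      refine le_trans (Real.log_le_log (by positivity) ?_) (log_one_add_le_two_mul_log hT)
      have : ((T : ℝ) - 1) / lam ≤ (T - 1) / 1 := by gcongr; linarith
      linarith
    have h2 : -Real.log (δ / 2) ≤ -Real.log (δ / 2) / Real.log 2 * Real.log T := by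
      rw [div_mul_eq_mul_div, le_div_iff₀ hlog2]
      gcongr
    linarith [add_mul 2 (-Real.log (δ / 2) / Real.log 2) (Real.log T)]
  have hfirst : √(d * Real.log ((1 + ((T : ℝ) - 1) / lam) / (δ / 2))) ≤
      √K * √(d * Real.log T) := by
    rw [← Real.sqrt_mul hK]
    apply Real.sqrt_le_sqrt
    calc d * Real.log ((1 + ((T : ℝ) - 1) / lam) / (δ / 2)) ≤ d * (K * Real.log T) := by gcongr
      _ = K * (d * Real.log T) := by ring
  have hsecond : √(Real.log 2) ≤ √(d * Real.log T) := by
    apply Real.sqrt_le_sqrt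
    nlinarith
  have hsl : 0 < √(Real.log 2) := Real.sqrt_pos.2 hlog2
  unfold beta
  calc ρ * √(d * Real.log ((1 + ((T : ℝ) - 1) / lam) / (δ / 2))) + √lam * S
      ≤ ρ * (√K * √(d * Real.log T)) + √lam * S / √(Real.log 2) * √(d * Real.log T) := by
        refine add_le_add (by gcongr) ?_
        rw [div_mul_eq_mul_div, le_div_iff₀ hsl]
        gcongr
    _ = _ := by ring

/-- The confidence radius and the potential term each contribute `√(d log T)`, whose product is the
factor `d log T`. -/
lemma exists_regretBound_le {Sa Sθ ρ δ : ℝ} (hSa : 0 ≤ Sa) (hSθ : 0 ≤ Sθ) (hρ : 0 ≤ ρ)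
    (hδ : δ ∈ Set.Ioo (0 : ℝ) 1) (hlam : 1 ≤ lam) :
    ∃ C : ℝ, ∀ (d T : ℕ) (b : ℝ), 1 ≤ d → 2 ≤ T → 0 < b →
      regretBound d b Sa Sθ ρ δ lam T ≤ C * (d * √T / b) * Real.log T := by
  obtain ⟨C, hC0, hC⟩ := exists_beta_le hρ hδ hlam (le_max_of_le_left hSa : 0 ≤ max Sa Sθ)
  refine ⟨2 * (Sθ + Sa) * C * 2, fun d T b hd hT hb => ?_⟩
  have hT' : (2 : ℝ) ≤ T := by exact_mod_cast hT
  have hd' : (1 : ℝ) ≤ d := by exact_mod_cast hd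
  have hlogT : 0 ≤ Real.log T := Real.log_nonneg (by linarith)
  have hlog : Real.log (1 + T / (lam * d)) ≤ 2 * Real.log T := by
    refine le_trans (Real.log_le_log (by positivity) ?_) (log_one_add_le_two_mul_log hT)
    have : (T : ℝ) / (lam * d) ≤ T / 1 := by gcongr; nlinarith
    linarith
  have hsqrt : √(2 * d * T * Real.log (1 + T / (lam * d))) ≤ 2 * √T * √(d * Real.log T) := by
    have h4 : (2 : ℝ) = √4 := by rw [show (4 : ℝ) = 2 ^ 2 by norm_num]; simp
    have : √(2 * d * T * Real.log (1 + T / (lam * d))) ≤ √(4 * T * (d * Real.log T)) := by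
      apply Real.sqrt_le_sqrt
      calc 2 * d * T * Real.log (1 + T / (lam * d)) ≤ 2 * d * T * (2 * Real.log T) := by gcongr
        _ = _ := by ring
    refine this.trans (le_of_eq ?_)
    rw [Real.sqrt_mul (by positivity), Real.sqrt_mul (by norm_num), ← h4]
  unfold regretBound
  calc 2 * ((Sθ + Sa) / b) * beta d ρ δ lam (max Sa Sθ) T *
        √(2 * d * T * Real.log (1 + T / (lam * d)))
      ≤ 2 * ((Sθ + Sa) / b) * (C * √(d * Real.log T)) * (2 * √T * √(d * Real.log T)) := by
        gcongr
        exact hC d T hd hT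
    _ = 2 * (Sθ + Sa) * C * 2 * √T / b * (√(d * Real.log T) * √(d * Real.log T)) := by ring
    _ = _ := by
        rw [Real.mul_self_sqrt (by positivity)]
        ring

end Regret

end SafeBandit

end

/-! ### The main theorem -/

theorem theorem1
    {Ω : Type*} [MeasurableSpace Ω] (μ : Measure Ω) [IsProbabilityMeasure μ]
    -- the problem
    (d : ℕ) (hd : 2 ≤ d) (T : ℕ)
    (X : Set (SafeBandit.Vec d)) (θ a : SafeBandit.Vec d) (b : ℝ) (hb : 0 < b)
    (hX_closed : IsClosed X) (hX_star : StarConvex ℝ 0 X) (hX_norm : ∀ x ∈ X, ‖x‖ ≤ 1)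
    (xstar : SafeBandit.Vec d)
    (hxstar : SafeBandit.IsArgmax (fun x => inner ℝ θ x) (SafeBandit.feasible X a b) xstar)
    (hxstar_pos : 0 < inner ℝ θ xstar)
    (Sa Sθ : ℝ) (hSa : 0 < Sa) (hSθ : 0 < Sθ) (ha : ‖a‖ ≤ Sa) (hθ : ‖θ‖ ≤ Sθ)
    (hν : b / Sa ≤ 1)
    -- the parameters of the algorithm
    (ρ δ lam : ℝ) (hρ : 0 ≤ ρ) (hδ : δ ∈ Set.Ioo (0 : ℝ) 1) (hlam : 1 ≤ lam)
    -- the actions played and the noise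
    (x : ℕ → Ω → SafeBandit.Vec d) (ε η : ℕ → Ω → ℝ)
    (hx : ∀ t ∈ Finset.Icc 1 T, Measurable (x t))
    (hε : SafeBandit.CondSubgaussian μ ρ T x ε)
    (hη : SafeBandit.CondSubgaussian μ ρ T x η)
    (hrun : ∀ ω, SafeBandit.IsROFULRun X b Sa Sθ ρ δ lam T (fun t => x t ω)
      (fun t => inner ℝ θ (x t ω) + ε t ω) (fun t => inner ℝ a (x t ω) + η t ω)) :
    ENNReal.ofReal (1 - δ) ≤
        μ {ω | (∀ t ∈ Finset.Icc 1 T, x t ω ∈ SafeBandit.feasible X a b) ∧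
          SafeBandit.regret θ xstar (fun t => x t ω) T ≤
            SafeBandit.regretBound d b Sa Sθ ρ δ lam T} ∧
      ∃ C : ℝ, ∀ (d' T' : ℕ) (b' : ℝ), 1 ≤ d' → 2 ≤ T' → 0 < b' →
        SafeBandit.regretBound d' b' Sa Sθ ρ δ lam T' ≤ C * (d' * √T' / b') * Real.log T' := by
  refine ⟨?_, SafeBandit.exists_regretBound_le hSa.le hSθ.le hρ hδ hlam⟩
  have hlam0 : 0 < lam := by linarith
  have hν0 : 0 ≤ b / Sa := by positivity
  have hbS : b ≤ Sa := by rwa [div_le_one hSa] at hν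
  have hx1 : ∀ t ∈ Finset.Icc 1 T, ∀ ω, ‖x t ω‖ ≤ 1 := fun t ht ω =>
    hX_norm _ ((hrun ω t ht).mem hX_star hν0)
  obtain ⟨N₁, hN₁, h₁⟩ := hε.exists_weightedNorm_score_le hd hlam0 hρ hδ hx hx1
  obtain ⟨N₂, hN₂, h₂⟩ := hη.exists_weightedNorm_score_le hd hlam0 hρ hδ hx hx1
  set G := {ω | (∀ t ∈ Finset.Icc 1 T, x t ω ∈ SafeBandit.feasible X a b) ∧
    SafeBandit.regret θ xstar (fun t => x t ω) T ≤
      SafeBandit.regretBound d b Sa Sθ ρ δ lam T} with hG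
  -- Covering the whole space and using subadditivity avoids measurability of the good event and of
  -- the exceptional sets.
  have hcover : Set.univ ⊆ G ∪ (N₁ ∪ N₂) := by
    intro ω _
    by_cases hω : ω ∈ N₁ ∪ N₂
    · exact Or.inr hω
    refine Or.inl ?_
    rw [Set.mem_union, not_or] at hω
    have hconfθ := fun t ht => SafeBandit.abs_inner_ridge_sub_inner_le hlam0 (fun k => x k ω)
      (fun k => ε k ω) t (hθ.trans (le_max_right Sa Sθ)) (h₁ ω hω.1 t ht)
    have hconfa := fun t ht => SafeBandit.abs_inner_ridge_sub_inner_le hlam0 (fun k => x k ω)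
      (fun k => η k ω) t (ha.trans (le_max_left Sa Sθ)) (h₂ ω hω.2 t ht)
    refine ⟨fun t ht => (hrun ω t ht).mem_feasible hX_star hb.le hSa ha (hconfa t ht), ?_⟩
    exact SafeBandit.regret_le_regretBound (by omega) hlam hb hSa.le hSθ.le hρ hδ
      (fun t ht => hx1 t ht ω) fun t ht => (hrun ω t ht).regret_le hX_star hX_norm hb hν0
        (SafeBandit.beta_nonneg d δ lam hρ (le_max_of_le_left hSa.le) t) hbS hθ hxstar.1
        (hconfθ t ht) (hconfa t ht)
  have hN : μ (N₁ ∪ N₂) ≤ ENNReal.ofReal δ := by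
    calc μ (N₁ ∪ N₂) ≤ μ N₁ + μ N₂ := measure_union_le _ _
      _ ≤ ENNReal.ofReal (δ / 2) + ENNReal.ofReal (δ / 2) := add_le_add hN₁ hN₂
      _ = ENNReal.ofReal δ := by
          rw [← ENNReal.ofReal_add (by linarith [hδ.1]) (by linarith [hδ.1]), add_halves]
  rw [ENNReal.ofReal_sub _ hδ.1.le, ENNReal.ofReal_one, tsub_le_iff_right]
  calc 1 = μ Set.univ := measure_univ.symm
    _ ≤ μ G + μ (N₁ ∪ N₂) := (measure_mono hcover).trans (measure_union_le _ _)
    _ ≤ μ G + ENNReal.ofReal δ := by gcongr
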